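/- **Setting.** Let $\mathcal N$ be a smooth manifold of dimension $\mathfrak n\ge 2$. *Null metric hypersurface data* $\{\mathcal N,\gamma,\ell,\ell^{(2)}\}$ consist of a smooth symmetric $(0,2)$-tensor field $\gamma$ whose radical $\{v:\gamma(v,\cdot)=0\}$ is one-dimensional at every point, a smooth covector field $\ell$ and a smooth function $\ell^{(2)}$, such that the symmetric form $$\mathcal A\big((X,\alpha),(X',\alpha')\big)=\gamma(X,X')+\alpha\,\ell(X')+\alpha'\,\ell(X)+\alpha\alpha'\,\ell^{(2)}$$ on $T_p\mathcal N\oplus\mathbb R$ is non-degenerate at every $p$. The inverse form $\mathcal A^\sharp$ defines a symmetric tensor $P^{ab}$ and a vector field $n^a$ by $P(\omega,\eta)=\mathcal A^\sharp((\omega,0),(\eta,0))$ and $n(\omega)=\mathcal A^\sharp((\omega,0),(0,1))$; equivalently $\gamma_{ab}n^b=0$, $\ell_a n^a=1$, $P^{ab}\ell_b+\ell^{(2)}n^a=0$, $P^{ab}\gamma_{bc}+n^a\ell_c=\delta^a_c$. Let $\pounds$ be the Lie derivative, $d$ the exterior derivative (so $(d\ell)_{ab}=\partial_a\ell_b-\partial_b\ell_a$),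 round brackets denote symmetrization with factor $1/2$, and $\omega\otimes_s\eta=\frac12(\omega\otimes\eta+\eta\otimes\omega)$. Put $$U=\tfrac12\pounds_n\gamma,\qquad F=\tfrac12 d\ell,\qquad s_b=n^aF_{ab},\qquad \mathcal C=\ell\otimes\ell+\tfrac{\ell^{(2)}}{\mathfrak n-1}\gamma,\qquad Df=df-n(f)\,\ell ,\qquad \mathrm{tr}_P V=P^{ab}V_{ab}.$$ Let $\overset{\circ}{\nabla}$ be the unique torsion-free connection with $\overset{\circ}{\nabla}_a\gamma_{bc}=-U_{ab}\ell_c-U_{ac}\ell_b$ and $\overset{\circ}{\nabla}_a\ell_b+\overset{\circ}{\nabla}_b\ell_a=-2\ell^{(2)}U_{ab}$, and let $\overset{\circ}{R}_{ab}$ be its Ricci tensor, that is, the trace over the first and third indices of its curvature $\omega\big(\overset{\circ}{\nabla}_Z\overset{\circ}{\nabla}_WX-\overset{\circ}{\nabla}_W\overset{\circ}{\nabla}_ZX-\overset{\circ}{\nabla}_{[Z,W]}X\big)$, whose arguments are ordered as $(\omega,X,Z,W)$. For a symmetric $(0,2)$-tensor $V$ put $$Q_V=V_{ab}n^an^b,\quad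 \overline V^a=P^{ab}V_{bc}n^c-\tfrac12(\mathrm{tr}_PV)\,n^a,\quad \widehat V=\gamma(\overline V,\cdot),\quad V^H=V-2\,\ell\otimes_s\widehat V-Q_V\,\mathcal C-\tfrac{\mathrm{tr}_PV}{\mathfrak n-1}\gamma ,$$ and define the operators $$(\overline{\pounds}_nV)_{ab}=\pounds_nV_{ab}-2P^{cd}V_{c(a}U_{b)d}-4\widehat V_{(a}s_{b)}-\tfrac{Q_V}{\mathfrak n-1}\,n(\ell^{(2)})\,\gamma_{ab},$$ $$\mathcal O(\omega)_{ab}=\overset{\circ}{\nabla}_a\omega_b+\overset{\circ}{\nabla}_b\omega_a-2\ell_{(a}\big(\pounds_n\omega_{b)}-2U_{b)f}P^{fc}\omega_c\big)-\tfrac{2}{\mathfrak n-1}\,P^{cf}\overset{\circ}{\nabla}_c\omega_f\,\gamma_{ab}.$$ A *null shell* $\{\mathcal N,\gamma,\ell,\ell^{(2)},Y^{\pm},\epsilon\}$ consists of null metric hypersurface data, two smooth symmetric $(0,2)$-tensor fields $Y^+,Y^-$ and a sign $\epsilon\in\{1,-1\}$. For each $Y=Y^\pm$ put $r_a=Y_{ab}n^b$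 and $\kappa_n=-Y(n,n)$; the constraint tensor is $$\begin{aligned}\mathcal R_{ab}={}&\overset{\circ}{R}_{(ab)}-2\pounds_nY_{ab}-(2\kappa_n+\mathrm{tr}_PU)Y_{ab}+\overset{\circ}{\nabla}_{(a}\big(s_{b)}+2r_{b)}\big)-2r_ar_b+4r_{(a}s_{b)}-s_as_b\\&-(\mathrm{tr}_PY)U_{ab}+2P^{cd}U_{d(a}\big(2Y_{b)c}+F_{b)c}\big).\end{aligned}$$ Write $[A]=A^+-A^-$ and $\langle A\rangle=\frac12(A^++A^-)$. The energy density, pressure, transverse energy flux and impulsive gravitational wave of the shell are $$\mu=-\epsilon[\mathrm{tr}_PY],\qquad p=\epsilon[\kappa_n],\qquad J=\epsilon\big[\overline Y-\ell(\overline Y)\,n\big],\qquad \Upsilon=\epsilon[Y^H],$$ and $\widehat J=\gamma(J,\cdot)$. **Proposition 7.1.** For every null shell with $\mathfrak n\ge2$ the jump of the constraint tensor satisfies $$\begin{aligned}\epsilon[\mathcal R_{ab}]={}&\ell_{(a}\Big(-2\pounds_n\widehat J_{b)}-2(\mathrm{tr}_PU)\widehat J_{b)}-2D_{b)}p+4s_{b)}p\Big)+p\,(\mathrm{tr}_PU)\,\mathcal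 C_{ab}\\ &+\frac{2}{\mathfrak n-1}\Big(n\big(\ell^{(2)}p+\mu\big)+\mathrm{tr}_P\big(\overset{\circ}{\nabla}\widehat J-2\langle\widehat Y\rangle\otimes_s\widehat J-2\widehat J\otimes_s s\big)+2\ell^{(2)}\langle\kappa_n\rangle p\\ &\hspace{16mm}+\langle\kappa_n\rangle\,\mu-\langle\mathrm{tr}_PY\rangle\,p+(\mathrm{tr}_PU)\big(\ell^{(2)}p+\mu\big)\Big)\gamma_{ab}\\ &-2(\overline{\pounds}_n\Upsilon)_{ab}+\mathcal O(\widehat J)_{ab}-4\big(\langle\widehat Y\rangle\otimes_s\widehat J\big)^H_{ab}-4\big(s\otimes_s\widehat J\big)^H_{ab}-2\langle\kappa_n\rangle\Upsilon_{ab}-2p\,\langle Y^H\rangle_{ab}\\ &-(\mathrm{tr}_PU)\Upsilon_{ab}+\big(\mu+2\ell^{(2)}p\big)U^H_{ab}.\end{aligned}$$ -/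

import Mathlib

open scoped Manifold ContDiff Bundle

noncomputable section

namespace NullShells

/-! ## Tensor fields in a coordinate system

The coordinate domain is an open subset of `ℝᵐ`; a tensor field is given by its component
functions.  An index `a : Fin m` is a coordinate index. -/

/-- The coordinate space `ℝᵐ`. -/
abbrev E (m : ℕ) := EuclideanSpace ℝ (Fin m)

/-- Scalar functions `f`. -/
abbrev Scalar (m : ℕ) := E m → ℝ

/-- Components `X^a` of a vector field. -/
abbrev Vec (m : ℕ) := E m → Fin m → ℝ

/-- Components `w_a` of a covector field. -/
abbrev Covec (m : ℕ) := E m → Fin m → ℝ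

/-- Components `T_ab` (or `T^ab`) of a tensor field with two indices. -/
abbrev Tensor (m : ℕ) := E m → Fin m → Fin m → ℝ

variable {m : ℕ}

/-- The partial derivative `∂_a f`. -/
def pd (a : Fin m) (f : Scalar m) : Scalar m :=
  fun x => fderiv ℝ f x (EuclideanSpace.single a 1)

/-- Symmetrization `T_(ab) = (T_ab + T_ba) / 2`. -/
def sym (T : Tensor m) : Tensor m := fun x a b => (T x a b + T x b a) / 2

/-- The tensor product `w ⊗ η` of covectors. -/
def tens (w η : Covec m) : Tensor m := fun x a b => w x a * η x b

/-- The symmetrized tensor product `w ⊗ₛ η = (w ⊗ η + η ⊗ w) / 2` of covectors. -/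
def stens (w η : Covec m) : Tensor m := sym (tens w η)

/-- Components in a coordinate system of metric data `{γ, ℓ, ℓ⁽²⁾}`. -/
structure LocalData (m : ℕ) where
  /-- the degenerate metric `γ_ab` -/
  γ : Tensor m
  /-- the covector `ℓ_a` -/
  ell : Covec m
  /-- the scalar `ℓ⁽²⁾` -/
  ell2 : Scalar m

namespace LocalData

variable (D : LocalData m)

/-- The matrix of the form `𝒜((X,a),(X',a')) = γ(X,X') + a ℓ(X') + a' ℓ(X) + a a' ℓ⁽²⁾` on
`T_pN ⊕ ℝ`, in the basis `(∂_a, 0), (0, 1)`. -/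
def ambient (x : E m) : Matrix (Fin m ⊕ Unit) (Fin m ⊕ Unit) ℝ :=
  Matrix.fromBlocks (Matrix.of (D.γ x)) (Matrix.of fun a _ => D.ell x a)
    (Matrix.of fun _ a => D.ell x a) (Matrix.of fun _ _ => D.ell2 x)

/-- `P^ab`: the tangential block of the contravariant tensor `𝒜^♯` inverse to `𝒜`. -/
def P : Tensor m := fun x a b => (D.ambient x)⁻¹ (Sum.inl a) (Sum.inl b)

/-- `n^a`: the mixed block of the contravariant tensor `𝒜^♯` inverse to `𝒜`. -/
def nv : Vec m := fun x a => (D.ambient x)⁻¹ (Sum.inl a) (Sum.inr ())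

/-- The trace `tr_P V = P^ab V_ab`. -/
def trP (V : Tensor m) : Scalar m := fun x => ∑ a, ∑ b, D.P x a b * V x a b

/-- The contraction `(ι_n V)_b = V_ab n^a`. -/
def iota (V : Tensor m) : Covec m := fun x b => ∑ a, D.nv x a * V x a b

/-- The scalar `Q_V = V_ab n^a n^b`. -/
def Q (V : Tensor m) : Scalar m := fun x => ∑ a, ∑ b, V x a b * D.nv x a * D.nv x b

/-- The vector `V̄^a = P^ab (ι_n V)_b - (1/2) (tr_P V) n^a`. -/
def bar (V : Tensor m) : Vec m :=
  fun x a => (∑ b, D.P x a b * D.iota V x b) - 1 / 2 * D.trP V x * D.nv x a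

/-- The covector `γ(X, ·)` (underhat). -/
def hat (X : Vec m) : Covec m := fun x a => ∑ b, X x b * D.γ x b a

/-- The vector `X - ℓ(X) n` (underline). -/
def under (X : Vec m) : Vec m := fun x a => X x a - (∑ b, D.ell x b * X x b) * D.nv x a

/-- The tensor `𝒞 = ℓ ⊗ ℓ + ℓ⁽²⁾ / (m - 1) γ`. -/
def C : Tensor m :=
  fun x a b => D.ell x a * D.ell x b + D.ell2 x / ((m : ℝ) - 1) * D.γ x a b

/-- The projector `ℙ(V) = 2 ℓ ⊗ₛ γ(V̄, ·) + Q_V 𝒞 + (tr_P V) / (m - 1) γ`. -/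
def proj (V : Tensor m) : Tensor m := fun x a b =>
  2 * stens D.ell (D.hat (D.bar V)) x a b + D.Q V x * D.C x a b
    + D.trP V x / ((m : ℝ) - 1) * D.γ x a b

/-- The component `V^H = V - ℙ(V)` of `V` in the kernel of the energy-momentum map. -/
def hor (V : Tensor m) : Tensor m := fun x a b => V x a b - D.proj V x a b

/-- The derivative `n(f)` of a function. -/
def nDer (f : Scalar m) : Scalar m := fun x => ∑ c, D.nv x c * pd c f x

/-- The Lie derivative `£_n w` of a covector field. -/
def lieCov (w : Covec m) : Covec m := fun x a =>
  ∑ c, (D.nv x c * pd c (fun y => w y a) x + w x c * pd a (fun y => D.nv y c) x)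

/-- The Lie derivative `£_n V` of a (0,2)-tensor field. -/
def lieTen (V : Tensor m) : Tensor m := fun x a b =>
  ∑ c, (D.nv x c * pd c (fun y => V y a b) x + V x c b * pd a (fun y => D.nv y c) x
    + V x a c * pd b (fun y => D.nv y c) x)

/-- `U = (1/2) £_n γ`. -/
def U : Tensor m := fun x a b => 1 / 2 * D.lieTen D.γ x a b

/-- `F = (1/2) dℓ`. -/
def F : Tensor m := fun x a b =>
  1 / 2 * (pd a (fun y => D.ell y b) x - pd b (fun y => D.ell y a) x)

/-- `s = ι_n F`. -/
def s : Covec m := D.iota D.F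

/-- The covector `Df = df - n(f) ℓ`. -/
def Dd (f : Scalar m) : Covec m := fun x a => pd a f x - D.nDer f x * D.ell x a

/-- The metric hypersurface connection: `christoffel x c a b` is `Γ^c_ab`, that is,
`∇_{∂_a} ∂_b = Γ^c_ab ∂_c`.  `NullMetricHypersurfaceData.eq_christoffel_iff` below shows that these
are the coefficients of the unique torsion-free connection with
`∇_a γ_bc = - U_ab ℓ_c - U_ac ℓ_b` and `∇_a ℓ_b + ∇_b ℓ_a = - 2 ℓ⁽²⁾ U_ab`. -/
def christoffel (x : E m) (c a b : Fin m) : ℝ :=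
  1 / 2 * (∑ d, D.P x c d * (pd a (fun y => D.γ y b d) x + pd b (fun y => D.γ y a d) x
    - pd d (fun y => D.γ y a b) x))
  + 1 / 2 * D.nv x c * (pd a (fun y => D.ell y b) x + pd b (fun y => D.ell y a) x)

/-- `(∇w)_ab = ∇_a w_b`, the covariant derivative of a covector field with respect to the
metric hypersurface connection. -/
def nabla (w : Covec m) : Tensor m := fun x a b =>
  pd a (fun y => w y b) x - ∑ c, D.christoffel x c a b * w x c

/-- The curvature `dx^a (∇_c ∇_d ∂_b - ∇_d ∇_c ∂_b)` of the metric hypersurface connection. -/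
def riem (x : E m) (a b c d : Fin m) : ℝ :=
  pd c (fun y => D.christoffel y a d b) x - pd d (fun y => D.christoffel y a c b) x
    + ∑ e, (D.christoffel x a c e * D.christoffel x e d b
      - D.christoffel x a d e * D.christoffel x e c b)

/-- The Ricci tensor of the metric hypersurface connection: the trace of the curvature in the
first and third indices.  It need not be symmetric. -/
def ric : Tensor m := fun x a b => ∑ c, D.riem x c a c b

/-- `(a, b) ↦ P^cd T_ca S_bd`. -/
def PTS (T S : Tensor m) : Tensor m := fun x a b =>
  ∑ c, ∑ d, D.P x c d * T x c a * S x b d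

/-- The algebraic map `𝔅(V)_ab = - 2 P^cd V_c(a U_b)d - 4 γ(V̄,·)_(a s_b) - Q_V/(m-1) n(ℓ⁽²⁾) γ_ab`. -/
def B (V : Tensor m) : Tensor m := fun x a b =>
  -2 * sym (D.PTS V D.U) x a b - 4 * stens (D.hat (D.bar V)) D.s x a b
    - D.Q V x / ((m : ℝ) - 1) * D.nDer D.ell2 x * D.γ x a b

/-- The operator `L̄_n V = £_n V + 𝔅(V)`. -/
def lieBar (V : Tensor m) : Tensor m := fun x a b => D.lieTen V x a b + D.B V x a b

/-- The operator `𝒪(w)_ab = ∇_a w_b + ∇_b w_a - 2 ℓ_(a (£_n w_b) - 2 U_b)f P^fc w_c)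
- 2/(m-1) P^cf ∇_c w_f γ_ab`. -/
def O (w : Covec m) : Tensor m := fun x a b =>
  D.nabla w x a b + D.nabla w x b a
    - 2 * stens D.ell
        (fun y b => D.lieCov w y b - 2 * ∑ f, ∑ c, D.U y b f * D.P y f c * w y c) x a b
    - 2 / ((m : ℝ) - 1) * D.trP (D.nabla w) x * D.γ x a b

/-- `r = ι_n Y`. -/
def r (Y : Tensor m) : Covec m := D.iota Y

/-- `κ_n = - Y(n, n)`. -/
def kappa (Y : Tensor m) : Scalar m := fun x => - D.Q Y x

/-- The constraint tensor `ℛ_ab` of the null hypersurface data `{γ, ℓ, ℓ⁽²⁾, Y}`. -/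
def constraintTensor (Y : Tensor m) : Tensor m := fun x a b =>
  sym D.ric x a b - 2 * D.lieTen Y x a b - (2 * D.kappa Y x + D.trP D.U x) * Y x a b
    + sym (D.nabla fun y c => D.s y c + 2 * D.r Y y c) x a b
    - 2 * D.r Y x a * D.r Y x b + 4 * stens (D.r Y) D.s x a b - D.s x a * D.s x b
    - D.trP Y x * D.U x a b
    + 2 * sym (fun y a b => ∑ c, ∑ d,
        D.P y c d * D.U y d a * (2 * Y y b c + D.F y b c)) x a b

end LocalData

/-- Components in a coordinate system of a null shell `{γ, ℓ, ℓ⁽²⁾, Y⁺, Y⁻, ε}`. -/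
structure LocalShell (m : ℕ) extends LocalData m where
  /-- the tensor `Y⁺_ab` -/
  Yp : Tensor m
  /-- the tensor `Y⁻_ab` -/
  Ym : Tensor m
  /-- the sign `ε` -/
  ε : ℝ

namespace LocalShell

variable (S : LocalShell m)

/-- The energy density `μ = - ε [tr_P Y]`. -/
def μ : Scalar m := fun x => - S.ε * (S.trP S.Yp x - S.trP S.Ym x)

/-- The pressure `p = ε [κ_n]`. -/
def p : Scalar m := fun x => S.ε * (S.kappa S.Yp x - S.kappa S.Ym x)

/-- The transverse energy flux `J^a = ε [Ȳ - ℓ(Ȳ) n]^a`. -/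
def J : Vec m := fun x a => S.ε * (S.under (S.bar S.Yp) x a - S.under (S.bar S.Ym) x a)

/-- The covector `γ(J, ·)`. -/
def hatJ : Covec m := S.hat S.J

/-- The impulsive gravitational wave `Υ = ε [Y^H]`. -/
def Υ : Tensor m := fun x a b => S.ε * (S.hor S.Yp x a b - S.hor S.Ym x a b)

/-- The average on the two sides of the covector `γ(Ȳ, ·)`. -/
def avY : Covec m := fun x a => 1 / 2 * (S.hat (S.bar S.Yp) x a + S.hat (S.bar S.Ym) x a)

/-- The average of `κ_n`. -/
def avKappa : Scalar m := fun x => 1 / 2 * (S.kappa S.Yp x + S.kappa S.Ym x)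

/-- The average of `tr_P Y`. -/
def avTr : Scalar m := fun x => 1 / 2 * (S.trP S.Yp x + S.trP S.Ym x)

/-- The average of `Y^H`. -/
def avHor : Tensor m := fun x a b => 1 / 2 * (S.hor S.Yp x a b + S.hor S.Ym x a b)

/-- The jump `[ℛ_ab]` of the constraint tensor. -/
def jumpR : Tensor m := fun x a b =>
  S.constraintTensor S.Yp x a b - S.constraintTensor S.Ym x a b

end LocalShell

/-! ## Null hypersurface data on a manifold -/

section Manifold

variable (m : ℕ) (N : Type*) [TopologicalSpace N] [ChartedSpace (E m) N]
  [IsManifold (𝓡 m) ∞ N]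

/-- A smooth symmetric (0,2)-tensor field on the manifold `N`. -/
structure SymTensorField where
  /-- the bilinear form at each point -/
  toFun : ∀ p : N, TangentSpace (𝓡 m) p →L[ℝ] TangentSpace (𝓡 m) p →L[ℝ] ℝ
  symm : ∀ (p : N) (v w : TangentSpace (𝓡 m) p), toFun p v w = toFun p w v
  smooth : ContMDiff (𝓡 m) ((𝓡 m).prod 𝓘(ℝ, E m →L[ℝ] E m →L[ℝ] ℝ)) ∞
    (fun p => Bundle.TotalSpace.mk' (E m →L[ℝ] E m →L[ℝ] ℝ)
      (E := fun p : N => TangentSpace (𝓡 m) p →L[ℝ] TangentSpace (𝓡 m) p →L[ℝ] ℝ) p (toFun p))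

/-- A smooth covector field on the manifold `N`. -/
structure CovectorField where
  /-- the covector at each point -/
  toFun : ∀ p : N, TangentSpace (𝓡 m) p →L[ℝ] ℝ
  smooth : ContMDiff (𝓡 m) ((𝓡 m).prod 𝓘(ℝ, E m →L[ℝ] ℝ)) ∞
    (fun p => Bundle.TotalSpace.mk' (E m →L[ℝ] ℝ)
      (E := fun p : N => TangentSpace (𝓡 m) p →L[ℝ] ℝ) p (toFun p))

/-- Null metric hypersurface data `{N, γ, ℓ, ℓ⁽²⁾}` on an `m`-dimensional manifold `N`. -/
structure NullMetricHypersurfaceData where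
  /-- the degenerate metric -/
  γ : SymTensorField m N
  /-- the covector field `ℓ` -/
  ell : CovectorField m N
  /-- the function `ℓ⁽²⁾` -/
  ell2 : N → ℝ
  ell2_smooth : ContMDiff (𝓡 m) 𝓘(ℝ, ℝ) ∞ ell2
  /-- the radical `{v | γ(v, ·) = 0}` is one-dimensional at every point -/
  radical : ∀ p : N, Module.finrank ℝ (γ.toFun p).ker = 1
  /-- the form `𝒜` on `T_pN ⊕ ℝ` is non-degenerate at every point -/
  nondegenerate : ∀ (p : N) (v : TangentSpace (𝓡 m) p) (a : ℝ),
    (∀ (w : TangentSpace (𝓡 m) p) (b : ℝ),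
      γ.toFun p v w + a * ell.toFun p w + b * ell.toFun p v + a * b * ell2 p = 0) →
    v = 0 ∧ a = 0

/-- A null shell: two null hypersurface data `{N, γ, ℓ, ℓ⁽²⁾, Y^±}` with the same metric part,
and a sign `ε`. -/
structure NullShell extends NullMetricHypersurfaceData m N where
  /-- the tensor `Y⁺` -/
  Yp : SymTensorField m N
  /-- the tensor `Y⁻` -/
  Ym : SymTensorField m N
  /-- the sign `ε` -/
  ε : ℝ
  ε_sign : ε = 1 ∨ ε = -1

end Manifold

section Coordinates

variable {N : Type*} [TopologicalSpace N] [ChartedSpace (E m) N]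

/-- The coordinate vector `∂_a` of the chart `φ`, at the point with coordinates `x`. -/
def coordVec (φ : OpenPartialHomeomorph N (E m)) (x : E m) (a : Fin m) :
    TangentSpace (𝓡 m) (φ.symm x) :=
  mfderiv (𝓡 m) (𝓡 m) φ.symm x
    ((NormedSpace.fromTangentSpace (𝕜 := ℝ) x).symm (EuclideanSpace.single a 1))

variable [IsManifold (𝓡 m) ∞ N]

/-- The components `T_ab = T(∂_a, ∂_b)` in the chart `φ`. -/
def SymTensorField.comp (T : SymTensorField m N) (φ : OpenPartialHomeomorph N (E m)) : Tensor m :=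
  fun x a b => T.toFun (φ.symm x) (coordVec φ x a) (coordVec φ x b)

/-- The components `w_a = w(∂_a)` in the chart `φ`. -/
def CovectorField.comp (w : CovectorField m N) (φ : OpenPartialHomeomorph N (E m)) : Covec m :=
  fun x a => w.toFun (φ.symm x) (coordVec φ x a)

/-- Null metric hypersurface data in the chart `φ`. -/
def NullMetricHypersurfaceData.inChart (D : NullMetricHypersurfaceData m N)
    (φ : OpenPartialHomeomorph N (E m)) : LocalData m where
  γ := D.γ.comp φ
  ell := D.ell.comp φ
  ell2 := fun x => D.ell2 (φ.symm x)

/-- A null shell in the chart `φ`. -/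
def NullShell.inChart (S : NullShell m N) (φ : OpenPartialHomeomorph N (E m)) : LocalShell m where
  toLocalData := S.toNullMetricHypersurfaceData.inChart φ
  Yp := S.Yp.comp φ
  Ym := S.Ym.comp φ
  ε := S.ε

end Coordinates

/-! ## The coordinate expressions match the defining properties of `P`, `n` and the connection -/

section Checks

variable {m : ℕ} {N : Type*} [TopologicalSpace N] [ChartedSpace (E m) N] [IsManifold (𝓡 m) ∞ N]

theorem coordVec_smooth {φ : OpenPartialHomeomorph N (E m)}
    (hφ : φ ∈ IsManifold.maximalAtlas (𝓡 m) ∞ N) (a : Fin m) :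
    ContMDiffOn (𝓡 m) ((𝓡 m).prod (𝓡 m)) ∞
      (fun x => Bundle.TotalSpace.mk' (E m) (E := fun p : N => TangentSpace (𝓡 m) p)
        (φ.symm x) (coordVec φ x a)) φ.target := by
  have h1 := (contMDiffOn_symm_of_mem_maximalAtlas hφ).contMDiffOn_tangentMapWithin
    (m := ∞) (by simp) (φ.open_target.uniqueMDiffOn)
  have h2 : ContMDiffOn (𝓡 m) ((𝓡 m).prod (𝓡 m)) ∞
      (fun x : E m => (Bundle.TotalSpace.mk' (E m) (E := fun p : E m => TangentSpace (𝓡 m) p) x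
        ((NormedSpace.fromTangentSpace (𝕜 := ℝ) x).symm (EuclideanSpace.single a 1)))) φ.target :=
    contMDiffOn_vectorSpace_iff_contDiffOn.2 contDiffOn_const
  have h3 := h1.comp h2 (fun x hx => hx)
  refine h3.congr fun x hx => ?_
  simp only [Function.comp, tangentMapWithin, coordVec]
  rw [mfderivWithin_of_isOpen φ.open_target hx]

theorem SymTensorField.comp_smooth (T : SymTensorField m N) {φ : OpenPartialHomeomorph N (E m)}
    (hφ : φ ∈ IsManifold.maximalAtlas (𝓡 m) ∞ N) (a b : Fin m) :
    ContDiffOn ℝ ∞ (fun x => T.comp φ x a b) φ.target := by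
  rw [← contMDiffOn_iff_contDiffOn]
  intro x hx
  have hb := (contMDiffOn_symm_of_mem_maximalAtlas hφ) x hx
  have : ContMDiffWithinAt (𝓡 m) ((𝓡 m).prod 𝓘(ℝ)) ∞
      (fun y => Bundle.TotalSpace.mk' ℝ (E := Bundle.Trivial N ℝ) (φ.symm y)
        (T.toFun (φ.symm y) (coordVec φ y a) (coordVec φ y b))) φ.target x := by
    apply ContMDiffWithinAt.clm_bundle_apply₂ (F₁ := E m) (F₂ := E m)
    · exact ContMDiffAt.comp_contMDiffWithinAt x T.smooth.contMDiffAt hb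
    · exact coordVec_smooth hφ a x hx
    · exact coordVec_smooth hφ b x hx
  simp only [Bundle.contMDiffWithinAt_totalSpace] at this
  exact this.2

theorem CovectorField.comp_smooth (w : CovectorField m N) {φ : OpenPartialHomeomorph N (E m)}
    (hφ : φ ∈ IsManifold.maximalAtlas (𝓡 m) ∞ N) (a : Fin m) :
    ContDiffOn ℝ ∞ (fun x => w.comp φ x a) φ.target := by
  rw [← contMDiffOn_iff_contDiffOn]
  intro x hx
  have hb := (contMDiffOn_symm_of_mem_maximalAtlas hφ) x hx
  have : ContMDiffWithinAt (𝓡 m) ((𝓡 m).prod 𝓘(ℝ)) ∞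
      (fun y => Bundle.TotalSpace.mk' ℝ (E := Bundle.Trivial N ℝ) (φ.symm y)
        (w.toFun (φ.symm y) (coordVec φ y a))) φ.target x := by
    apply ContMDiffWithinAt.clm_bundle_apply (F₁ := E m)
    · exact ContMDiffAt.comp_contMDiffWithinAt x w.smooth.contMDiffAt hb
    · exact coordVec_smooth hφ a x hx
  simp only [Bundle.contMDiffWithinAt_totalSpace] at this
  exact this.2

theorem NullMetricHypersurfaceData.ell2_comp_smooth (D : NullMetricHypersurfaceData m N)
    {φ : OpenPartialHomeomorph N (E m)} (hφ : φ ∈ IsManifold.maximalAtlas (𝓡 m) ∞ N) :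
    ContDiffOn ℝ ∞ (D.inChart φ).ell2 φ.target := by
  rw [← contMDiffOn_iff_contDiffOn]
  exact D.ell2_smooth.comp_contMDiffOn (contMDiffOn_symm_of_mem_maximalAtlas hφ)

theorem coordVec_basis {m : ℕ} {N : Type*} [TopologicalSpace N] [ChartedSpace (E m) N]
    {φ : OpenPartialHomeomorph N (E m)}
    (hφ : φ ∈ IsManifold.maximalAtlas (𝓡 m) ∞ N) {x : E m} (hx : x ∈ φ.target) :
    (∀ v : TangentSpace (𝓡 m) (φ.symm x), ∃ c : Fin m → ℝ, v = ∑ a, c a • coordVec φ x a) ∧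
    (∀ c : Fin m → ℝ, ∑ a, c a • coordVec φ x a = 0 → c = 0) := by
  have hmd : φ.MDifferentiable (𝓡 m) (𝓡 m) :=
    ⟨(contMDiffOn_of_mem_maximalAtlas hφ).mdifferentiableOn (by simp),
      (contMDiffOn_symm_of_mem_maximalAtlas hφ).mdifferentiableOn (by simp)⟩
  have hbij := hmd.symm.mfderiv_bijective (x := x) hx
  have hsum : ∀ c : Fin m → ℝ,
      (WithLp.toLp 2 c : E m) = ∑ a, c a • EuclideanSpace.single a (1 : ℝ) := by
    intro c
    ext i
    simp [Pi.single_apply]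
  have key : ∀ c : Fin m → ℝ, ∑ a, c a • coordVec φ x a
      = mfderiv (𝓡 m) (𝓡 m) φ.symm x
        ((NormedSpace.fromTangentSpace (𝕜 := ℝ) x).symm (WithLp.toLp 2 c : E m)) := by
    intro c
    rw [hsum c, map_sum, map_sum]
    refine Finset.sum_congr rfl fun a _ => ?_
    rw [map_smul, map_smul]
    rfl
  constructor
  · intro v
    obtain ⟨u, hu⟩ := hbij.2 v
    refine ⟨fun a => (NormedSpace.fromTangentSpace (𝕜 := ℝ) x u) a, ?_⟩
    rw [key, ← hu]
    congr 1
  · intro c hc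
    rw [key] at hc
    have h0 := hbij.1 (hc.trans (map_zero _).symm)
    rw [map_eq_zero_iff _ (ContinuousLinearEquiv.injective _)] at h0
    ext a
    simpa using congrArg (fun u : E m => u a) h0

theorem ambient_mulVec (D : LocalData m) (x : E m) (c : Fin m → ℝ) (t : ℝ) :
    (D.ambient x).mulVec (Sum.elim c fun _ => t)
      = Sum.elim (fun a => ∑ b, D.γ x a b * c b + D.ell x a * t)
          (fun _ => ∑ b, D.ell x b * c b + D.ell2 x * t) := by
  ext i
  rcases i with i | i <;>
    simp [LocalData.ambient, Matrix.mulVec, dotProduct]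

theorem NullMetricHypersurfaceData.sum_apply (D : NullMetricHypersurfaceData m N)
    (φ : OpenPartialHomeomorph N (E m)) (x : E m) (c d : Fin m → ℝ) :
    D.γ.toFun (φ.symm x) (∑ a, c a • coordVec φ x a) (∑ a, d a • coordVec φ x a)
      = ∑ a, d a * ∑ b, (D.inChart φ).γ x a b * c b := by
  have h : ∀ a b, (D.inChart φ).γ x a b
      = D.γ.toFun (φ.symm x) (coordVec φ x b) (coordVec φ x a) := fun a b => D.γ.symm _ _ _
  simp only [h, map_sum, map_smul, _root_.sum_apply, smul_apply,
    smul_eq_mul]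
  refine Finset.sum_congr rfl fun a _ => ?_
  congr 1
  exact Finset.sum_congr rfl fun b _ => mul_comm _ _

theorem NullMetricHypersurfaceData.ell_sum_apply (D : NullMetricHypersurfaceData m N)
    (φ : OpenPartialHomeomorph N (E m)) (x : E m) (c : Fin m → ℝ) :
    D.ell.toFun (φ.symm x) (∑ a, c a • coordVec φ x a)
      = ∑ a, (D.inChart φ).ell x a * c a := by
  simp only [map_sum, map_smul, smul_eq_mul]
  exact Finset.sum_congr rfl fun b _ => mul_comm _ _

/-- The components of `𝒜` form an invertible matrix. -/
theorem NullMetricHypersurfaceData.det_ambient_ne_zero (D : NullMetricHypersurfaceData m N)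
    {φ : OpenPartialHomeomorph N (E m)} (hφ : φ ∈ IsManifold.maximalAtlas (𝓡 m) ∞ N)
    {x : E m} (hx : x ∈ φ.target) : ((D.inChart φ).ambient x).det ≠ 0 := by
  obtain ⟨hspan, hind⟩ := coordVec_basis hφ hx
  intro hdet
  obtain ⟨u, hu0, hu⟩ := Matrix.exists_mulVec_eq_zero_iff.2 hdet
  apply hu0
  have hue : u = Sum.elim (fun a => u (Sum.inl a)) (fun _ => u (Sum.inr ())) := by
    ext i; rcases i with i | i <;> rfl
  rw [hue, ambient_mulVec] at hu
  have h1 : ∀ a, ∑ b, (D.inChart φ).γ x a b * u (Sum.inl b)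
      + (D.inChart φ).ell x a * u (Sum.inr ()) = 0 := fun a => congrFun hu (Sum.inl a)
  have h2 : ∑ b, (D.inChart φ).ell x b * u (Sum.inl b)
      + (D.inChart φ).ell2 x * u (Sum.inr ()) = 0 := congrFun hu (Sum.inr ())
  have := D.nondegenerate (φ.symm x) (∑ a, u (Sum.inl a) • coordVec φ x a) (u (Sum.inr ())) ?_
  · have h3 := hind _ this.1
    rw [hue]
    ext i
    rcases i with i | i
    · exact congrFun h3 i
    · exact this.2
  · intro w b
    obtain ⟨d, rfl⟩ := hspan w
    rw [D.sum_apply φ x, D.ell_sum_apply, D.ell_sum_apply]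
    have h1' : ∑ a, d a * (∑ b, (D.inChart φ).γ x a b * u (Sum.inl b)
      + (D.inChart φ).ell x a * u (Sum.inr ())) = 0 :=
        Finset.sum_eq_zero fun a _ => by rw [h1 a, mul_zero]
    have h4 : ∑ a, d a * (∑ b, (D.inChart φ).γ x a b * u (Sum.inl b)
        + (D.inChart φ).ell x a * u (Sum.inr ()))
        = ∑ a, d a * (∑ b, (D.inChart φ).γ x a b * u (Sum.inl b))
          + u (Sum.inr ()) * ∑ a, (D.inChart φ).ell x a * d a := by
      rw [Finset.mul_sum, ← Finset.sum_add_distrib]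
      exact Finset.sum_congr rfl fun a _ => by ring
    have h5 : (D.inChart φ).ell2 x = D.ell2 (φ.symm x) := rfl
    rw [h5] at h2
    linear_combination h1' - h4 + b * h2

/-- The defining relations of `P` and `n`. -/
theorem NullMetricHypersurfaceData.relations (D : NullMetricHypersurfaceData m N)
    {φ : OpenPartialHomeomorph N (E m)} (hφ : φ ∈ IsManifold.maximalAtlas (𝓡 m) ∞ N)
    {x : E m} (hx : x ∈ φ.target) :
    (∀ a, ∑ b, (D.inChart φ).γ x a b * (D.inChart φ).nv x b = 0) ∧
    (∑ a, (D.inChart φ).ell x a * (D.inChart φ).nv x a = 1) ∧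
    (∀ a, ∑ b, (D.inChart φ).P x a b * (D.inChart φ).ell x b
      + (D.inChart φ).ell2 x * (D.inChart φ).nv x a = 0) ∧
    (∀ a c, ∑ b, (D.inChart φ).P x a b * (D.inChart φ).γ x b c
      + (D.inChart φ).nv x a * (D.inChart φ).ell x c = if a = c then 1 else 0) := by
  have hdet := D.det_ambient_ne_zero hφ hx
  obtain ⟨hspan, hind⟩ := coordVec_basis hφ hx
  set Z := D.inChart φ with hZ
  have hu : IsUnit (Z.ambient x).det := isUnit_iff_ne_zero.2 hdet
  -- a nonzero radical vector
  obtain ⟨v, hv0, hv⟩ : ∃ v, v ≠ 0 ∧ D.γ.toFun (φ.symm x) v = 0 := by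
    have hr := D.radical (φ.symm x)
    have : Nontrivial (D.γ.toFun (φ.symm x)).ker :=
      Module.nontrivial_of_finrank_pos (R := ℝ) (by omega)
    obtain ⟨⟨v, hv⟩, hne⟩ := exists_ne (0 : (D.γ.toFun (φ.symm x)).ker)
    exact ⟨v, fun h => hne (Subtype.ext h), hv⟩
  obtain ⟨c, rfl⟩ := hspan v
  have hgc : ∀ a, ∑ b, Z.γ x a b * c b = 0 := by
    intro a
    have h0 := D.sum_apply φ x c (Pi.single a 1)
    rw [hv] at h0
    simpa [Pi.single_apply] using h0.symm
  set t := ∑ b, Z.ell x b * c b with ht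
  have hmv : (Z.ambient x).mulVec (Sum.elim c fun _ => 0) = Sum.elim (fun _ => 0) fun _ => t := by
    rw [ambient_mulVec]
    ext i
    rcases i with i | i
    · simpa using hgc i
    · simp [ht]
  have hinv : Sum.elim c (fun _ => (0 : ℝ)) = ((Z.ambient x)⁻¹).mulVec (Sum.elim (fun _ => 0) fun _ => t) := by
    rw [← hmv, Matrix.mulVec_mulVec, Matrix.nonsing_inv_mul _ hu, Matrix.one_mulVec]
  have hc : ∀ a, c a = Z.nv x a * t := by
    intro a
    have := congrFun hinv (Sum.inl a)
    simpa [Matrix.mulVec, dotProduct, LocalData.nv] using this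
  have hk : (Z.ambient x)⁻¹ (Sum.inr ()) (Sum.inr ()) * t = 0 := by
    have := congrFun hinv (Sum.inr ())
    simpa [Matrix.mulVec, dotProduct] using this.symm
  have ht0 : t ≠ 0 := by
    intro h0
    apply hv0
    refine Finset.sum_eq_zero fun a _ => ?_
    rw [hc, h0, mul_zero, zero_smul]
  have hk0 : (Z.ambient x)⁻¹ (Sum.inr ()) (Sum.inr ()) = 0 := by
    simpa [ht0] using hk
  have hA : Z.ambient x * (Z.ambient x)⁻¹ = 1 := Matrix.mul_nonsing_inv _ hu
  have hB : (Z.ambient x)⁻¹ * Z.ambient x = 1 := Matrix.nonsing_inv_mul _ hu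
  refine ⟨fun a => ?_, ?_, fun a => ?_, fun a d => ?_⟩
  · have := congrFun (congrFun hA (Sum.inl a)) (Sum.inr ())
    rw [Matrix.mul_apply, Fintype.sum_sum_type, Fintype.sum_unique (ι := Unit),
      show (default : Unit) = () from rfl, hk0, mul_zero, add_zero] at this
    exact this.trans (by simp)
  · have := congrFun (congrFun hA (Sum.inr ())) (Sum.inr ())
    rw [Matrix.mul_apply, Fintype.sum_sum_type, Fintype.sum_unique (ι := Unit),
      show (default : Unit) = () from rfl, hk0, mul_zero, add_zero] at this
    exact this.trans (by simp)
  · have := congrFun (congrFun hB (Sum.inl a)) (Sum.inr ())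
    rw [Matrix.mul_apply, Fintype.sum_sum_type] at this
    simpa [LocalData.ambient, LocalData.P, LocalData.nv, mul_comm] using this
  · have := congrFun (congrFun hB (Sum.inl a)) (Sum.inl d)
    rw [Matrix.mul_apply, Fintype.sum_sum_type] at this
    simpa [LocalData.ambient, LocalData.P, LocalData.nv, Matrix.one_apply] using this

theorem contDiffOn_det {ι : Type*} [Fintype ι] [DecidableEq ι] {s : Set (E m)}
    {A : E m → Matrix ι ι ℝ} (h : ∀ i j, ContDiffOn ℝ ∞ (fun x => A x i j) s) :
    ContDiffOn ℝ ∞ (fun x => (A x).det) s := by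
  simp only [Matrix.det_apply']
  exact ContDiffOn.sum fun σ _ => contDiffOn_const.mul (contDiffOn_prod fun i _ => h _ _)

theorem contDiffOn_inv {ι : Type*} [Fintype ι] [DecidableEq ι] {s : Set (E m)}
    {A : E m → Matrix ι ι ℝ} (h : ∀ i j, ContDiffOn ℝ ∞ (fun x => A x i j) s)
    (h0 : ∀ x ∈ s, (A x).det ≠ 0) (i j : ι) : ContDiffOn ℝ ∞ (fun x => (A x)⁻¹ i j) s := by
  simp only [Matrix.inv_def, Ring.inverse_eq_inv', Matrix.smul_apply, smul_eq_mul,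
    Matrix.adjugate_apply]
  refine ((contDiffOn_det h).inv h0).mul (contDiffOn_det fun k l => ?_)
  simp only [Matrix.updateRow_apply]
  split_ifs
  · exact contDiffOn_const
  · exact h _ _

theorem NullMetricHypersurfaceData.inv_smooth (D : NullMetricHypersurfaceData m N)
    {φ : OpenPartialHomeomorph N (E m)} (hφ : φ ∈ IsManifold.maximalAtlas (𝓡 m) ∞ N)
    (i j : Fin m ⊕ Unit) :
    ContDiffOn ℝ ∞ (fun x => ((D.inChart φ).ambient x)⁻¹ i j) φ.target := by
  refine contDiffOn_inv (fun i j => ?_) (fun x hx => D.det_ambient_ne_zero hφ hx) i j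
  rcases i with i | i <;> rcases j with j | j
  · exact D.γ.comp_smooth hφ i j
  · exact D.ell.comp_smooth hφ i
  · exact D.ell.comp_smooth hφ j
  · exact D.ell2_comp_smooth hφ

theorem NullMetricHypersurfaceData.nv_smooth (D : NullMetricHypersurfaceData m N)
    {φ : OpenPartialHomeomorph N (E m)} (hφ : φ ∈ IsManifold.maximalAtlas (𝓡 m) ∞ N)
    (a : Fin m) : ContDiffOn ℝ ∞ (fun x => (D.inChart φ).nv x a) φ.target :=
  D.inv_smooth hφ _ _

/-- The functions `Γ^c_ab` are the coefficients of the unique torsion-free connection with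
`∇_a γ_bc = - U_ab ℓ_c - U_ac ℓ_b` and `∇_a ℓ_b + ∇_b ℓ_a = - 2 ℓ⁽²⁾ U_ab`. -/
theorem NullMetricHypersurfaceData.eq_christoffel_iff (D : NullMetricHypersurfaceData m N)
    {φ : OpenPartialHomeomorph N (E m)} (hφ : φ ∈ IsManifold.maximalAtlas (𝓡 m) ∞ N)
    {x : E m} (hx : x ∈ φ.target) (Γ : Fin m → Fin m → Fin m → ℝ) :
    Γ = (D.inChart φ).christoffel x ↔
      (∀ c a b, Γ c a b = Γ c b a) ∧
      (∀ a b c, pd a (fun y => (D.inChart φ).γ y b c) x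
          - (∑ d, Γ d a b * (D.inChart φ).γ x d c) - (∑ d, Γ d a c * (D.inChart φ).γ x b d)
        = - (D.inChart φ).U x a b * (D.inChart φ).ell x c
          - (D.inChart φ).U x a c * (D.inChart φ).ell x b) ∧
      (∀ a b, (pd a (fun y => (D.inChart φ).ell y b) x - ∑ c, Γ c a b * (D.inChart φ).ell x c)
          + (pd b (fun y => (D.inChart φ).ell y a) x - ∑ c, Γ c b a * (D.inChart φ).ell x c)
        = - 2 * (D.inChart φ).ell2 x * (D.inChart φ).U x a b) := by
  have hg : ∀ y a b, (D.inChart φ).γ y a b = (D.inChart φ).γ y b a :=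
    fun y a b => D.γ.symm _ _ _
  obtain ⟨r1, r2, r3, r4⟩ := D.relations hφ hx
  have hnhds := φ.open_target.mem_nhds hx
  have dg : ∀ a b, DifferentiableAt ℝ (fun y => (D.inChart φ).γ y a b) x := fun a b =>
    ((D.γ.comp_smooth hφ a b).contDiffAt hnhds).differentiableAt (by simp)
  have dn : ∀ a, DifferentiableAt ℝ (fun y => (D.inChart φ).nv y a) x := fun a =>
    ((D.nv_smooth hφ a).contDiffAt hnhds).differentiableAt (by simp)
  have r1d : ∀ a b, ∑ d, pd a (fun y => (D.inChart φ).γ y b d) x * (D.inChart φ).nv x d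
      = - ∑ d, (D.inChart φ).γ x b d * pd a (fun y => (D.inChart φ).nv y d) x := by
    intro a b
    have h0 : pd a (fun y => ∑ d, (D.inChart φ).γ y b d * (D.inChart φ).nv y d) x = 0 := by
      have : (fun y => ∑ d, (D.inChart φ).γ y b d * (D.inChart φ).nv y d)
          =ᶠ[nhds x] fun _ => (0 : ℝ) :=
        Filter.eventually_of_mem hnhds fun y hy => (D.relations hφ hy).1 b
      simp [pd, this.fderiv_eq]
    unfold pd at h0 ⊢
    rw [fderiv_fun_sum (A := fun d y => (D.inChart φ).γ y b d * (D.inChart φ).nv y d)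
      (fun d _ => (dg b d).mul (dn d))] at h0
    simp only [_root_.sum_apply] at h0
    rw [eq_neg_iff_add_eq_zero, ← Finset.sum_add_distrib, ← h0]
    refine Finset.sum_congr rfl fun d _ => ?_
    rw [fderiv_fun_mul (dg b d) (dn d)]
    simp
    ring
  set Z := D.inChart φ
  have hgd : ∀ c a b, pd c (fun y => Z.γ y a b) x = pd c (fun y => Z.γ y b a) x := by
    intro c a b
    congr 1
    ext y
    exact hg y a b
  -- contraction of the Christoffel combination with `n`
  let K : Fin m → Fin m → Fin m → ℝ := fun a b d => pd a (fun y => Z.γ y b d) x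
    + pd b (fun y => Z.γ y a d) x - pd d (fun y => Z.γ y a b) x
  have hU : ∀ a b, ∑ d, Z.nv x d * K a b d = - 2 * Z.U x a b := by
    intro a b
    have e1 := r1d a b
    have e2 := r1d b a
    have e : ∑ d, Z.nv x d * K a b d
        = (∑ d, pd a (fun y => Z.γ y b d) x * Z.nv x d)
          + (∑ d, pd b (fun y => Z.γ y a d) x * Z.nv x d)
          - ∑ d, Z.nv x d * pd d (fun y => Z.γ y a b) x := by
      rw [← Finset.sum_add_distrib, ← Finset.sum_sub_distrib]
      exact Finset.sum_congr rfl fun d _ => by simp only [K]; ring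
    rw [e, e1, e2]
    simp only [LocalData.U, LocalData.lieTen, Finset.sum_add_distrib]
    have e3 : ∑ d, Z.γ x b d * pd a (fun y => Z.nv y d) x
        = ∑ d, Z.γ x d b * pd a (fun y => Z.nv y d) x :=
      Finset.sum_congr rfl fun d _ => by rw [hg x b d]
    rw [e3]
    ring
  have hUs : ∀ a b, Z.U x a b = Z.U x b a := by
    intro a b
    have e : ∑ d, Z.nv x d * K a b d = ∑ d, Z.nv x d * K b a d := by
      refine Finset.sum_congr rfl fun d _ => ?_
      simp only [K]
      rw [hgd d a b]
      ring
    rw [hU, hU] at e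
    linarith
  have hPs : ∀ a b, Z.P x a b = Z.P x b a := by
    intro a b
    have hs : (Z.ambient x).transpose = Z.ambient x := by
      ext i j
      rcases i with i | i <;> rcases j with j | j <;>
        simp [LocalData.ambient, Matrix.transpose_apply]
      exact hg x j i
    have := Matrix.transpose_nonsing_inv (Z.ambient x)
    rw [hs] at this
    exact congrFun (congrFun this (Sum.inl b)) (Sum.inl a)
  -- lowering the upper index
  have L1 : ∀ a b c, ∑ d, Z.christoffel x d a b * Z.γ x d c
      = 1 / 2 * K a b c + Z.ell x c * Z.U x a b := by
    intro a b c
    have e : ∀ d, Z.christoffel x d a b * Z.γ x d c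
        = 1 / 2 * (∑ e, Z.P x d e * Z.γ x d c * K a b e)
          + Z.γ x c d * Z.nv x d * (1 / 2 * (pd a (fun y => Z.ell y b) x
            + pd b (fun y => Z.ell y a) x)) := by
      intro d
      have : Z.christoffel x d a b = 1 / 2 * (∑ e, Z.P x d e * K a b e)
        + 1 / 2 * Z.nv x d * (pd a (fun y => Z.ell y b) x
            + pd b (fun y => Z.ell y a) x) := rfl
      rw [this, hg x c d, add_mul, mul_assoc, Finset.sum_mul]
      congr 1
      · congr 1
        exact Finset.sum_congr rfl fun e _ => by ring
      · ring
    simp only [e, Finset.sum_add_distrib]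
    rw [← Finset.sum_mul, r1, zero_mul, add_zero, ← Finset.mul_sum, Finset.sum_comm]
    have e2 : ∀ e, ∑ d, Z.P x d e * Z.γ x d c * K a b e
        = (if e = c then 1 else 0) * K a b e - Z.ell x c * (Z.nv x e * K a b e) := by
      intro e
      rw [← Finset.sum_mul, ← r4 e c]
      have : ∑ i, Z.P x i e * Z.γ x i c = ∑ b, Z.P x e b * Z.γ x b c :=
        Finset.sum_congr rfl fun d _ => by rw [hPs d e]
      rw [this]
      ring
    simp only [e2, Finset.sum_sub_distrib, ← Finset.mul_sum, hU]
    simp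
    ring
  have L2 : ∀ a b, ∑ d, Z.christoffel x d a b * Z.ell x d
      = Z.ell2 x * Z.U x a b + 1 / 2 * (pd a (fun y => Z.ell y b) x
            + pd b (fun y => Z.ell y a) x) := by
    intro a b
    have e : ∀ d, Z.christoffel x d a b * Z.ell x d
        = 1 / 2 * (∑ e, Z.P x d e * Z.ell x d * K a b e)
          + Z.ell x d * Z.nv x d * (1 / 2 * (pd a (fun y => Z.ell y b) x
            + pd b (fun y => Z.ell y a) x)) := by
      intro d
      have : Z.christoffel x d a b = 1 / 2 * (∑ e, Z.P x d e * K a b e)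
        + 1 / 2 * Z.nv x d * (pd a (fun y => Z.ell y b) x
            + pd b (fun y => Z.ell y a) x) := rfl
      rw [this, add_mul, mul_assoc, Finset.sum_mul]
      congr 1
      · congr 1
        exact Finset.sum_congr rfl fun e _ => by ring
      · ring
    simp only [e, Finset.sum_add_distrib]
    rw [← Finset.sum_mul, r2, one_mul, ← Finset.mul_sum, Finset.sum_comm]
    congr 1
    have e2 : ∀ e, ∑ d, Z.P x d e * Z.ell x d * K a b e
        = - Z.ell2 x * (Z.nv x e * K a b e) := by
      intro e
      rw [← Finset.sum_mul]
      have : ∑ i, Z.P x i e * Z.ell x i = ∑ b, Z.P x e b * Z.ell x b :=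
        Finset.sum_congr rfl fun d _ => by rw [hPs d e]
      rw [this]
      linear_combination K a b e * r3 e
    simp only [e2, ← Finset.mul_sum, hU]
    ring
  have Ls : ∀ c a b, Z.christoffel x c a b = Z.christoffel x c b a := by
    intro c a b
    have : ∀ a b, Z.christoffel x c a b = 1 / 2 * (∑ e, Z.P x c e * K a b e)
        + 1 / 2 * Z.nv x c * (pd a (fun y => Z.ell y b) x
            + pd b (fun y => Z.ell y a) x) := fun _ _ => rfl
    rw [this, this, add_comm (pd a _ x)]
    congr 2
    refine Finset.sum_congr rfl fun d _ => ?_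
    simp only [K]
    rw [hgd d a b]
    ring
  constructor
  · rintro rfl
    refine ⟨Ls, fun a b c => ?_, fun a b => ?_⟩
    · have e : ∑ d, Z.christoffel x d a c * Z.γ x b d = ∑ d, Z.christoffel x d a c * Z.γ x d b :=
        Finset.sum_congr rfl fun d _ => by rw [hg x b d]
      rw [e, L1, L1]
      simp only [K]
      rw [hgd a c b, hgd b a c, hgd c a b]
      rw [hgd b c a, hgd c b a]
      ring
    · rw [L2, L2, hUs b a]
      ring
  · rintro ⟨h1, h2, h3⟩
    have M2 : ∀ a b, ∑ d, Γ d a b * Z.ell x d = ∑ d, Z.christoffel x d a b * Z.ell x d := by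
      intro a b
      have e := h3 a b
      have e' : ∑ c, Γ c b a * Z.ell x c = ∑ c, Γ c a b * Z.ell x c :=
        Finset.sum_congr rfl fun d _ => by rw [h1 d a b]
      rw [e'] at e
      rw [L2]
      linarith
    have M1 : ∀ a b c, ∑ d, Γ d a b * Z.γ x d c = ∑ d, Z.christoffel x d a b * Z.γ x d c := by
      have q : ∀ a b c, pd a (fun y => Z.γ y b c) x - (∑ d, Γ d a b * Z.γ x d c)
          - (∑ d, Γ d a c * Z.γ x d b) = - Z.U x a b * Z.ell x c - Z.U x a c * Z.ell x b := by
        intro a b c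
        rw [← h2 a b c]
        congr 1
        exact Finset.sum_congr rfl fun d _ => by rw [hg x b d]
      have q1 : ∀ a b c, ∑ d, Γ d a b * Z.γ x d c = ∑ d, Γ d b a * Z.γ x d c := fun a b c =>
        Finset.sum_congr rfl fun d _ => by rw [h1 d a b]
      intro a b c
      rw [L1]
      simp only [K]
      have k1 := q a b c
      have k2 := q b a c
      have k3 := q c a b
      rw [q1 c a b, q1 c b a] at k3
      rw [q1 b a c] at k2
      rw [hUs c a, hUs c b] at k3
      rw [hUs b a] at k2
      linarith
    funext c a b
    have key : ∀ G : Fin m → Fin m → Fin m → ℝ, G c a b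
        = (∑ e, Z.P x c e * ∑ d, G d a b * Z.γ x d e)
          + Z.nv x c * ∑ d, G d a b * Z.ell x d := by
      intro G
      have : G c a b = ∑ d, (if c = d then 1 else 0) * G d a b := by simp
      rw [this]
      simp only [← r4 c, add_mul, Finset.sum_add_distrib, Finset.mul_sum, Finset.sum_mul]
      rw [Finset.sum_comm]
      congr 1
      · refine Finset.sum_congr rfl fun e _ => Finset.sum_congr rfl fun d _ => ?_
        rw [hg x d e]
        ring
      · exact Finset.sum_congr rfl fun d _ => by ring
    rw [key Γ, key (Z.christoffel x)]
    simp only [M1, M2]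

end Checks

end NullShells

end

/-! The constraint tensor is a polynomial of degree at most two in `Y`. In the jump the part free of
`Y` (Ricci tensor, `∇s`, `s ⊗ s`, the `U`-`F` contraction) cancels, and the only quadratic parts,
`κ_n Y` and `r ⊗ r`, are polarized by `[AB] = ⟨A⟩[B] + [A]⟨B⟩`. Hence `ε[ℛ]` is linear in `V =
ε[Y]`, with coefficients built from the metric data and from `⟨Y⟩`; this is `LocalShell.jumpR_eq`.

It remains to insert the decomposition `V = V^H + 2 ℓ ⊗ₛ V̂ + Q_V 𝒞 + (tr_P V)/(m-1) γ`, in which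
`V^H = Υ`, `V̂ = Ĵ`, `Q_V = -p` and `tr_P V = -μ`, and likewise for `⟨Y⟩` in the polarized terms.
Three terms need work: `£_n V` (`lieTen_decomp`), `∇(ι_n V)` (`nabla_iota`) and the contraction of
`V` with `P` and `U` (`PTS_decomp`). They rest on `£_n γ = 2U`, `£_n ℓ = 2s`, `U(n,·) = 0`, `s(n) =
0`, the symmetrized `∇ℓ` being `-ℓ⁽²⁾U`, and `ι_n V = V̂ + Q_V ℓ` (`hat_bar`).

The terms in `U/(m-1)` from the Lie derivative cancel those from the `P`-`U` contraction, leaving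
`(μ + 2ℓ⁽²⁾p) U`. Every tensor under `(·)^H` on the right, other than `⟨Y⟩`, is annihilated by `n`,
so there `(·)^H` only subtracts a trace. The bracket multiplying `γ` restores the traces removed by
`𝒪` and by `(·)^H`. The rest is commutative algebra. -/

namespace NullShells

variable {m : ℕ}

/-! ## Partial derivatives -/

theorem pd_congr {f g : Scalar m} {x : E m} (h : f =ᶠ[nhds x] g) (a : Fin m) :
    pd a f x = pd a g x := by
  simp only [pd, h.fderiv_eq]

theorem pd_add {f g : Scalar m} {x : E m} (hf : DifferentiableAt ℝ f x)
    (hg : DifferentiableAt ℝ g x) (a : Fin m) :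
    pd a (fun y => f y + g y) x = pd a f x + pd a g x := by
  simp [pd, fderiv_fun_add hf hg]

theorem pd_mul {f g : Scalar m} {x : E m} (hf : DifferentiableAt ℝ f x)
    (hg : DifferentiableAt ℝ g x) (a : Fin m) :
    pd a (fun y => f y * g y) x = pd a f x * g x + f x * pd a g x := by
  simp [pd, fderiv_fun_mul hf hg]
  ring

theorem pd_const (c : ℝ) (x : E m) (a : Fin m) : pd a (fun _ => c) x = 0 := by
  simp [pd]

theorem pd_const_mul {f : Scalar m} {x : E m} (hf : DifferentiableAt ℝ f x) (c : ℝ)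
    (a : Fin m) : pd a (fun y => c * f y) x = c * pd a f x := by
  rw [pd_mul (differentiableAt_const c) hf, pd_const]
  ring

theorem pd_sum {ι : Type*} {s : Finset ι} {f : ι → Scalar m} {x : E m}
    (hf : ∀ i, DifferentiableAt ℝ (f i) x) (a : Fin m) :
    pd a (fun y => ∑ i ∈ s, f i y) x = ∑ i ∈ s, pd a (f i) x := by
  simp only [pd]
  rw [fderiv_fun_sum fun i _ => hf i]
  simp

theorem stens_apply (w η : Covec m) (x : E m) (a b : Fin m) :
    stens w η x a b = (w x a * η x b + w x b * η x a) / 2 := rfl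

namespace LocalData

variable {D : LocalData m} {x : E m}

/-! ## Leibniz rules -/

theorem nDer_add {f g : Scalar m} (hf : DifferentiableAt ℝ f x) (hg : DifferentiableAt ℝ g x) :
    D.nDer (fun y => f y + g y) x = D.nDer f x + D.nDer g x := by
  simp only [nDer, pd_add hf hg, mul_add, Finset.sum_add_distrib]

theorem nDer_mul {f g : Scalar m} (hf : DifferentiableAt ℝ f x) (hg : DifferentiableAt ℝ g x) :
    D.nDer (fun y => f y * g y) x = D.nDer f x * g x + f x * D.nDer g x := by
  simp only [nDer, pd_mul hf hg, Finset.mul_sum, Finset.sum_mul, ← Finset.sum_add_distrib]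
  exact Finset.sum_congr rfl fun c _ => by ring

theorem nDer_const (c : ℝ) : D.nDer (fun _ => c) x = 0 := by
  simp [nDer, pd_const]

theorem lieTen_add {V W : Tensor m} (hV : ∀ a b, DifferentiableAt ℝ (fun y => V y a b) x)
    (hW : ∀ a b, DifferentiableAt ℝ (fun y => W y a b) x) (a b : Fin m) :
    D.lieTen (fun y a b => V y a b + W y a b) x a b = D.lieTen V x a b + D.lieTen W x a b := by
  simp only [lieTen, pd_add (hV a b) (hW a b), ← Finset.sum_add_distrib]
  exact Finset.sum_congr rfl fun c _ => by ring

theorem lieTen_mul {f : Scalar m} {V : Tensor m} (hf : DifferentiableAt ℝ f x)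
    (hV : ∀ a b, DifferentiableAt ℝ (fun y => V y a b) x) (a b : Fin m) :
    D.lieTen (fun y a b => f y * V y a b) x a b
      = D.nDer f x * V x a b + f x * D.lieTen V x a b := by
  simp only [lieTen, nDer, pd_mul hf (hV a b), Finset.mul_sum, Finset.sum_mul,
    ← Finset.sum_add_distrib]
  exact Finset.sum_congr rfl fun c _ => by ring

theorem lieTen_const_mul {V : Tensor m} (t : ℝ)
    (hV : ∀ a b, DifferentiableAt ℝ (fun y => V y a b) x) (a b : Fin m) :
    D.lieTen (fun y a b => t * V y a b) x a b = t * D.lieTen V x a b := by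
  rw [lieTen_mul (differentiableAt_const t) hV, nDer_const]
  ring

theorem lieTen_comb {V W : Tensor m} (s t : ℝ)
    (hV : ∀ a b, DifferentiableAt ℝ (fun y => V y a b) x)
    (hW : ∀ a b, DifferentiableAt ℝ (fun y => W y a b) x) (a b : Fin m) :
    D.lieTen (s • V + t • W) x a b = s * D.lieTen V x a b + t * D.lieTen W x a b := by
  rw [← lieTen_const_mul s hV, ← lieTen_const_mul t hW]
  exact lieTen_add (fun a b => (hV a b).const_mul s) (fun a b => (hW a b).const_mul t) a b

theorem lieTen_tens {w η : Covec m} (hw : ∀ a, DifferentiableAt ℝ (fun y => w y a) x)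
    (hη : ∀ a, DifferentiableAt ℝ (fun y => η y a) x) (a b : Fin m) :
    D.lieTen (fun y a b => w y a * η y b) x a b
      = D.lieCov w x a * η x b + w x a * D.lieCov η x b := by
  simp only [lieTen, lieCov, pd_mul (hw a) (hη b), Finset.mul_sum, Finset.sum_mul,
    ← Finset.sum_add_distrib]
  exact Finset.sum_congr rfl fun c _ => by ring

theorem lieTen_stens {w η : Covec m} (hw : ∀ a, DifferentiableAt ℝ (fun y => w y a) x)
    (hη : ∀ a, DifferentiableAt ℝ (fun y => η y a) x) (a b : Fin m) :
    D.lieTen (stens w η) x a b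
      = stens (D.lieCov w) η x a b + stens w (D.lieCov η) x a b := by
  have e : stens w η = fun y a b => 1 / 2 * (w y a * η y b + η y a * w y b) := by
    ext y a b
    rw [stens_apply]
    ring
  rw [e, lieTen_const_mul, lieTen_add, lieTen_tens hw hη, lieTen_tens hη hw, stens_apply,
    stens_apply]
  · ring
  all_goals intros; fun_prop

theorem nabla_add {w η : Covec m} (hw : ∀ a, DifferentiableAt ℝ (fun y => w y a) x)
    (hη : ∀ a, DifferentiableAt ℝ (fun y => η y a) x) (a b : Fin m) :
    D.nabla (fun y a => w y a + η y a) x a b = D.nabla w x a b + D.nabla η x a b := by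
  simp only [nabla, pd_add (hw b) (hη b), mul_add, Finset.sum_add_distrib]
  ring

theorem nabla_mul {f : Scalar m} {w : Covec m} (hf : DifferentiableAt ℝ f x)
    (hw : ∀ a, DifferentiableAt ℝ (fun y => w y a) x) (a b : Fin m) :
    D.nabla (fun y a => f y * w y a) x a b = pd a f x * w x b + f x * D.nabla w x a b := by
  simp only [nabla, pd_mul hf (hw b), mul_sub, Finset.mul_sum]
  rw [add_sub_assoc]
  congr 2
  exact Finset.sum_congr rfl fun c _ => by ring

theorem nabla_congr {w η : Covec m} (h : ∀ᶠ y in nhds x, ∀ a, w y a = η y a) (a b : Fin m) :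
    D.nabla w x a b = D.nabla η x a b := by
  simp only [nabla, pd_congr (h.mono fun y hy => hy b), h.self_of_nhds]

theorem lieCov_congr {w η : Covec m} (h : ∀ᶠ y in nhds x, ∀ a, w y a = η y a) (a : Fin m) :
    D.lieCov w x a = D.lieCov η x a := by
  simp only [lieCov, pd_congr (h.mono fun y hy => hy a), h.self_of_nhds]

/-! ## Linearity of the algebraic operators -/

section Linear

variable (s t : ℝ) (V W : Tensor m)

theorem trP_comb : D.trP (s • V + t • W) x = s * D.trP V x + t * D.trP W x := by
  simp only [trP, Pi.add_apply, Pi.smul_apply, smul_eq_mul, Finset.mul_sum,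
    ← Finset.sum_add_distrib]
  exact Finset.sum_congr rfl fun a _ => Finset.sum_congr rfl fun b _ => by ring

theorem Q_comb : D.Q (s • V + t • W) x = s * D.Q V x + t * D.Q W x := by
  simp only [Q, Pi.add_apply, Pi.smul_apply, smul_eq_mul, Finset.mul_sum,
    ← Finset.sum_add_distrib]
  exact Finset.sum_congr rfl fun a _ => Finset.sum_congr rfl fun b _ => by ring

theorem iota_comb (b : Fin m) :
    D.iota (s • V + t • W) x b = s * D.iota V x b + t * D.iota W x b := by
  simp only [iota, Pi.add_apply, Pi.smul_apply, smul_eq_mul, Finset.mul_sum,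
    ← Finset.sum_add_distrib]
  exact Finset.sum_congr rfl fun a _ => by ring

theorem bar_comb (a : Fin m) :
    D.bar (s • V + t • W) x a = s * D.bar V x a + t * D.bar W x a := by
  simp only [bar, iota_comb, trP_comb, mul_add, Finset.sum_add_distrib, mul_left_comm _ s,
    mul_left_comm _ t, ← Finset.mul_sum]
  ring

theorem hat_comb (X Y : Vec m) (a : Fin m) :
    D.hat (s • X + t • Y) x a = s * D.hat X x a + t * D.hat Y x a := by
  simp only [hat, Pi.add_apply, Pi.smul_apply, smul_eq_mul, Finset.mul_sum,
    ← Finset.sum_add_distrib]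
  exact Finset.sum_congr rfl fun b _ => by ring

theorem hat_bar_comb (a : Fin m) :
    D.hat (D.bar (s • V + t • W)) x a
      = s * D.hat (D.bar V) x a + t * D.hat (D.bar W) x a := by
  rw [← hat_comb]
  congr 1
  ext y c
  exact bar_comb s t V W c

theorem hor_comb (a b : Fin m) :
    D.hor (s • V + t • W) x a b = s * D.hor V x a b + t * D.hor W x a b := by
  simp only [hor, proj, stens_apply, hat_bar_comb, Q_comb, trP_comb, Pi.add_apply,
    Pi.smul_apply, smul_eq_mul]
  ring

theorem PTS_comb (T : Tensor m) (a b : Fin m) :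
    D.PTS (s • V + t • W) T x a b = s * D.PTS V T x a b + t * D.PTS W T x a b := by
  simp only [PTS, Pi.add_apply, Pi.smul_apply, smul_eq_mul, Finset.mul_sum,
    ← Finset.sum_add_distrib]
  exact Finset.sum_congr rfl fun a _ => Finset.sum_congr rfl fun b _ => by ring

end Linear

/-! ## Pointwise consequences of the relations between `γ`, `ℓ`, `P` and `n` -/

/-- The relations satisfied at a point by metric data with one-dimensional radical. -/
structure NullAt (D : LocalData m) (x : E m) : Prop where
  symm : ∀ a b, D.γ x a b = D.γ x b a
  P_symm : ∀ a b, D.P x a b = D.P x b a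
  γ_nv : ∀ a, ∑ b, D.γ x a b * D.nv x b = 0
  ell_nv : ∑ a, D.ell x a * D.nv x a = 1
  P_ell : ∀ a, ∑ b, D.P x a b * D.ell x b = -D.ell2 x * D.nv x a
  P_γ : ∀ a c, ∑ b, D.P x a b * D.γ x b c = (if a = c then 1 else 0) - D.nv x a * D.ell x c

theorem Q_eq_sum_iota (V : Tensor m) : D.Q V x = ∑ b, D.iota V x b * D.nv x b := by
  simp only [Q, iota, Finset.sum_mul]
  rw [Finset.sum_comm]
  exact Finset.sum_congr rfl fun a _ => Finset.sum_congr rfl fun b _ => by ring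

theorem iota_stens (w η : Covec m) (b : Fin m) :
    D.iota (stens w η) x b
      = ((∑ a, w x a * D.nv x a) * η x b + (∑ a, η x a * D.nv x a) * w x b) / 2 := by
  simp only [iota, stens_apply, Finset.sum_mul, ← Finset.sum_add_distrib, Finset.sum_div]
  exact Finset.sum_congr rfl fun a _ => by ring

theorem trP_sub (V W : Tensor m) :
    D.trP (fun y a b => V y a b - W y a b) x = D.trP V x - D.trP W x := by
  have := trP_comb (D := D) (x := x) 1 (-1) V W
  rw [show (fun y a b => V y a b - W y a b) = (1 : ℝ) • V + (-1 : ℝ) • W by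
    ext y a b; simp [sub_eq_add_neg], this]
  ring

theorem trP_const_mul (t : ℝ) (V : Tensor m) :
    D.trP (fun y a b => t * V y a b) x = t * D.trP V x := by
  have := trP_comb (D := D) (x := x) t 0 V 0
  rw [show (fun y a b => t * V y a b) = t • V + (0 : ℝ) • (0 : Tensor m) by
    ext y a b; simp, this]
  ring

theorem stens_comm (w η : Covec m) : stens w η = stens η w := by
  ext y a b
  simp only [stens_apply]
  ring

namespace NullAt

theorem hat_nv_mul (h : D.NullAt x) (f : Scalar m) (c : Fin m) :
    D.hat (fun y a => f y * D.nv y a) x c = 0 := by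
  have := h.γ_nv c
  calc D.hat (fun y a => f y * D.nv y a) x c = f x * ∑ b, D.γ x c b * D.nv x b := by
        simp only [hat, Finset.mul_sum]
        exact Finset.sum_congr rfl fun b _ => by rw [h.symm b c]; ring
    _ = 0 := by rw [this, mul_zero]

theorem hat_under (h : D.NullAt x) (X : Vec m) (c : Fin m) :
    D.hat (D.under X) x c = D.hat X x c := by
  have e := hat_comb (D := D) (x := x) 1 (-1) X
    (fun y a => (∑ b, D.ell y b * X y b) * D.nv y a) c
  rw [h.hat_nv_mul, mul_zero, add_zero, one_mul] at e
  rw [← e]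
  congr 1
  ext y a
  simp [under, sub_eq_add_neg]

/-- The trace part of `V̄` is a multiple of `n`, which `γ` kills; on the rest `Pγ = δ - n ⊗ ℓ`, and
contracting `ι_n V` with `n` produces `Q_V`. Read backwards, this expresses `r = ι_n Y` through the
pieces of the decomposition. -/
theorem hat_bar (h : D.NullAt x) (V : Tensor m) (c : Fin m) :
    D.hat (D.bar V) x c = D.iota V x c - D.Q V x * D.ell x c := by
  have e := hat_comb (D := D) (x := x) 1 (-1) (fun y a => ∑ b, D.P y a b * D.iota V y b)
    (fun y a => (1 / 2 * D.trP V y) * D.nv y a) c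
  rw [h.hat_nv_mul, mul_zero, add_zero, one_mul] at e
  have e' : D.hat (D.bar V) x c = D.hat (fun y a => ∑ b, D.P y a b * D.iota V y b) x c := by
    rw [← e]
    congr 1
    ext y a
    simp [bar, sub_eq_add_neg]
  rw [e']
  simp only [hat, Finset.sum_mul]
  rw [Finset.sum_comm]
  have k : ∀ b, ∑ a, D.P x a b * D.iota V x b * D.γ x a c
      = D.iota V x b * ((if b = c then 1 else 0) - D.nv x b * D.ell x c) := by
    intro b
    rw [← h.P_γ b c, Finset.mul_sum]
    exact Finset.sum_congr rfl fun a _ => by rw [h.P_symm a b]; ring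
  simp only [k, mul_sub, Finset.sum_sub_distrib, mul_ite, mul_one, mul_zero,
    Finset.sum_ite_eq', Finset.mem_univ, if_true, Q_eq_sum_iota,
    Finset.sum_mul]
  congr 1
  exact Finset.sum_congr rfl fun b _ => by ring

theorem hat_bar_nv (h : D.NullAt x) (V : Tensor m) :
    ∑ a, D.hat (D.bar V) x a * D.nv x a = 0 := by
  have e := h.ell_nv
  simp only [h.hat_bar, sub_mul, Finset.sum_sub_distrib, mul_assoc, ← Finset.mul_sum, e,
    ← Q_eq_sum_iota]
  ring

theorem iota_γ (h : D.NullAt x) (b : Fin m) : D.iota D.γ x b = 0 := by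
  rw [← h.γ_nv b]
  exact Finset.sum_congr rfl fun a _ => by rw [h.symm a b, mul_comm]

/-- The projector carries the whole contraction of `V` with `n`: since `V̂(n) = 0` and `ℓ(n) = 1`,
its three terms contract to `V̂`, `Q_V ℓ` and `0`, whose sum is `ι_n V`. -/
theorem iota_hor (h : D.NullAt x) (V : Tensor m) (b : Fin m) : D.iota (D.hor V) x b = 0 := by
  have e1 := iota_stens (D := D) (x := x) D.ell (D.hat (D.bar V)) b
  rw [h.ell_nv, h.hat_bar_nv, h.hat_bar] at e1
  have e2 := h.iota_γ b
  have e3 := h.ell_nv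
  simp only [iota] at e1 e2 ⊢
  have k : ∀ a, D.nv x a * D.hor V x a b = D.nv x a * V x a b
      - 2 * (D.nv x a * stens D.ell (D.hat (D.bar V)) x a b)
      - D.Q V x * (D.ell x b * (D.ell x a * D.nv x a))
      - (D.Q V x * (D.ell2 x / ((m : ℝ) - 1)) + D.trP V x / ((m : ℝ) - 1))
        * (D.nv x a * D.γ x a b) := by
    intro a
    simp only [hor, proj, C]
    ring
  simp only [k, Finset.sum_sub_distrib, ← Finset.mul_sum, e1, e2, e3]
  ring

theorem Q_eq_zero_of_iota {V : Tensor m} (hV : ∀ b, D.iota V x b = 0) : D.Q V x = 0 := by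
  simp [Q_eq_sum_iota, hV]

theorem hat_bar_eq_zero_of_iota (h : D.NullAt x) {V : Tensor m} (hV : ∀ b, D.iota V x b = 0)
    (c : Fin m) : D.hat (D.bar V) x c = 0 := by
  simp [h.hat_bar, hV, Q_eq_zero_of_iota hV]

theorem hor_of_iota (h : D.NullAt x) {V : Tensor m} (hV : ∀ b, D.iota V x b = 0)
    (a b : Fin m) : D.hor V x a b = V x a b - D.trP V x / ((m : ℝ) - 1) * D.γ x a b := by
  simp only [hor, proj, stens_apply, h.hat_bar_eq_zero_of_iota hV, Q_eq_zero_of_iota hV]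
  ring

/-- Intended for `V = Υ`, for which the `V̂` and `Q_V` corrections in `𝔅` vanish. -/
theorem lieBar_of_iota (h : D.NullAt x) {V : Tensor m} (hV : ∀ b, D.iota V x b = 0)
    (a b : Fin m) : D.lieBar V x a b = D.lieTen V x a b - 2 * sym (D.PTS V D.U) x a b := by
  simp only [lieBar, B, stens_apply, h.hat_bar_eq_zero_of_iota hV, Q_eq_zero_of_iota hV]
  ring

/-- `Pγ` is the identity up to `n ⊗ ℓ`, and `T` kills the correction. -/
theorem PTS_γ (h : D.NullAt x) {T : Tensor m} (hT : ∀ a, ∑ b, T x a b * D.nv x b = 0)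
    (a b : Fin m) : D.PTS D.γ T x a b = T x b a := by
  have k : ∀ d, ∑ c, D.P x c d * D.γ x c a * T x b d
      = (if d = a then T x b d else 0) - D.ell x a * (T x b d * D.nv x d) := by
    intro d
    have := h.P_γ d a
    rw [← Finset.sum_mul, Finset.sum_congr rfl fun c _ => by rw [h.P_symm c d], this]
    split_ifs <;> ring
  rw [PTS, Finset.sum_comm]
  simp only [k, Finset.sum_sub_distrib, ← Finset.mul_sum, hT]
  simp

/-- In the half of `ℓ ⊗ₛ w` where `P` meets `ℓ`, the relation `Pℓ = -ℓ⁽²⁾ n` produces a factor `n`,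
which `T` annihilates; only the other half survives. -/
theorem PTS_stens_ell (h : D.NullAt x) {T : Tensor m} (hT : ∀ a, ∑ b, T x a b * D.nv x b = 0)
    (w : Covec m) (a b : Fin m) : D.PTS (stens D.ell w) T x a b
      = 1 / 2 * (D.ell x a * ∑ d, ∑ c, T x b d * D.P x d c * w x c) := by
  have k : ∀ d, ∑ c, D.P x c d * stens D.ell w x c a * T x b d
      = 1 / 2 * (D.ell x a * ∑ c, T x b d * D.P x d c * w x c)
        - 1 / 2 * w x a * D.ell2 x * (T x b d * D.nv x d) := by
    intro d
    have e : ∀ c, D.P x c d * stens D.ell w x c a * T x b d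
        = 1 / 2 * (D.ell x a * (T x b d * D.P x d c * w x c))
          + 1 / 2 * w x a * T x b d * (D.P x d c * D.ell x c) := by
      intro c
      rw [stens_apply, h.P_symm c d]
      ring
    simp only [e, Finset.sum_add_distrib, ← Finset.mul_sum, h.P_ell]
    ring
  rw [PTS, Finset.sum_comm]
  simp only [k, Finset.sum_sub_distrib, ← Finset.mul_sum, hT]
  ring

theorem s_nv : ∑ a, D.s x a * D.nv x a = 0 := by
  -- The sum is `F(n,n)` with `F` antisymmetric: exchanging the two indices changes its sign.
  have e : ∑ a, D.s x a * D.nv x a = -∑ a, D.s x a * D.nv x a := by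
    have k : ∑ a, D.s x a * D.nv x a = ∑ a, ∑ c, D.nv x c * D.F x c a * D.nv x a := by
      simp only [s, iota, Finset.sum_mul]
    rw [k]
    nth_rw 1 [Finset.sum_comm]
    simp only [← Finset.sum_neg_distrib]
    refine Finset.sum_congr rfl fun a _ => Finset.sum_congr rfl fun c _ => ?_
    simp only [F]
    ring
  linarith

end NullAt

/-! ## First-order consequences -/

theorem differentiableAt_div_const {f : E m → ℝ} (hf : DifferentiableAt ℝ f x) (c : ℝ) :
    DifferentiableAt ℝ (fun y => f y / c) x := by
  simp only [div_eq_mul_inv]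
  exact hf.mul_const _

/-- Metric data that are differentiable at `x` and satisfy the defining relations near `x`. -/
structure RegularAt (D : LocalData m) (x : E m) : Prop where
  null : ∀ᶠ y in nhds x, D.NullAt y
  γ_diff : ∀ a b, DifferentiableAt ℝ (fun y => D.γ y a b) x
  ell_diff : ∀ a, DifferentiableAt ℝ (fun y => D.ell y a) x
  ell2_diff : DifferentiableAt ℝ (fun y => D.ell2 y) x
  P_diff : ∀ a b, DifferentiableAt ℝ (fun y => D.P y a b) x
  nv_diff : ∀ a, DifferentiableAt ℝ (fun y => D.nv y a) x
  s_diff : ∀ a, DifferentiableAt ℝ (fun y => D.s y a) x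
  nabla_ell : ∀ a b, D.nabla D.ell x a b + D.nabla D.ell x b a = -2 * D.ell2 x * D.U x a b

theorem lieTen_γ (a b : Fin m) : D.lieTen D.γ x a b = 2 * D.U x a b := by
  simp only [U]
  ring

namespace RegularAt

variable (h : D.RegularAt x)
include h

theorem nullAt : D.NullAt x := h.null.self_of_nhds

theorem U_symm (a b : Fin m) : D.U x a b = D.U x b a := by
  have e : ∀ c, pd c (fun y => D.γ y a b) x = pd c (fun y => D.γ y b a) x := fun c =>
    pd_congr (h.null.mono fun y hy => hy.symm a b) c
  simp only [U, lieTen, e]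
  congr 1
  refine Finset.sum_congr rfl fun c _ => ?_
  rw [h.nullAt.symm a c, h.nullAt.symm b c]
  ring

/-- The Leibniz rule gives `(£_n γ)(·,n) = £_n(γ(·,n)) - γ(·,£_n n)`, and both terms vanish. The
hypothesis near `x`, not just at `x`, is needed to differentiate `γ(·,n) = 0`. -/
theorem U_nv (a : Fin m) : ∑ b, D.U x a b * D.nv x b = 0 := by
  have hg := h.γ_diff
  have hn := h.nv_diff
  have e0 : ∀ c, ∑ b, (pd c (fun y => D.γ y a b) x * D.nv x b
      + D.γ x a b * pd c (fun y => D.nv y b) x) = 0 := by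
    intro c
    have : pd c (fun y => ∑ b, D.γ y a b * D.nv y b) x = pd c (fun _ => 0) x :=
      pd_congr (h.null.mono fun y hy => hy.γ_nv a) c
    rw [pd_const, pd_sum fun b => (hg a b).fun_mul (hn b)] at this
    rw [← this]
    exact Finset.sum_congr rfl fun b _ => (pd_mul (hg a b) (hn b) c).symm
  -- The terms regroup into the derivative of `γ_ab n^b = 0` along `n` and a multiple of `γ_cb n^b =
  -- 0`.
  have e1 : ∑ b, D.U x a b * D.nv x b = 1 / 2 * (
      (∑ c, D.nv x c * ∑ b, (pd c (fun y => D.γ y a b) x * D.nv x b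
        + D.γ x a b * pd c (fun y => D.nv y b) x))
      + ∑ c, pd a (fun y => D.nv y c) x * ∑ b, D.γ x c b * D.nv x b) := by
    have e2 : ∑ b, ∑ c, D.γ x a c * pd b (fun y => D.nv y c) x * D.nv x b
        = ∑ c, ∑ b, D.nv x c * (D.γ x a b * pd c (fun y => D.nv y b) x) :=
      Finset.sum_congr rfl fun c _ => Finset.sum_congr rfl fun b _ => by ring
    have e3 : ∑ b, ∑ c, D.nv x c * pd c (fun y => D.γ y a b) x * D.nv x b
        = ∑ c, ∑ b, D.nv x c * (pd c (fun y => D.γ y a b) x * D.nv x b) := by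
      rw [Finset.sum_comm]
      exact Finset.sum_congr rfl fun c _ => Finset.sum_congr rfl fun b _ => by ring
    have e4 : ∑ b, ∑ c, D.γ x c b * pd a (fun y => D.nv y c) x * D.nv x b
        = ∑ c, ∑ b, pd a (fun y => D.nv y c) x * (D.γ x c b * D.nv x b) := by
      rw [Finset.sum_comm]
      exact Finset.sum_congr rfl fun c _ => Finset.sum_congr rfl fun b _ => by ring
    simp only [U, lieTen, mul_assoc (1 / 2 : ℝ), ← Finset.mul_sum, Finset.sum_mul, add_mul,
      Finset.sum_add_distrib, mul_add, e2, e3, e4]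
    simp only [Finset.mul_sum]
    ring
  rw [e1]
  simp only [e0, h.nullAt.γ_nv]
  simp

theorem iota_U (b : Fin m) : D.iota D.U x b = 0 := by
  rw [← h.U_nv b]
  exact Finset.sum_congr rfl fun a _ => by rw [h.U_symm a b, mul_comm]

/-- Cartan's formula `£_n ℓ = ι_n dℓ + d(ℓ(n))`, with `dℓ = 2F` and `ℓ(n) = 1` constant near `x`. -/
theorem lieCov_ell (a : Fin m) : D.lieCov D.ell x a = 2 * D.s x a := by
  have hl := h.ell_diff
  have hn := h.nv_diff
  have e0 : ∑ b, (pd a (fun y => D.ell y b) x * D.nv x b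
      + D.ell x b * pd a (fun y => D.nv y b) x) = 0 := by
    have : pd a (fun y => ∑ b, D.ell y b * D.nv y b) x = pd a (fun _ => 1) x :=
      pd_congr (h.null.mono fun y hy => hy.ell_nv) a
    rw [pd_const, pd_sum fun b => (hl b).fun_mul (hn b)] at this
    rw [← this]
    exact Finset.sum_congr rfl fun b _ => (pd_mul (hl b) (hn b) a).symm
  rw [← sub_zero (D.lieCov D.ell x a), ← e0]
  simp only [lieCov, s, iota, F, Finset.mul_sum, ← Finset.sum_sub_distrib]
  exact Finset.sum_congr rfl fun b _ => by ring

theorem C_diff (a b : Fin m) : DifferentiableAt ℝ (fun y => D.C y a b) x :=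
  ((h.ell_diff a).mul (h.ell_diff b)).add
    ((differentiableAt_div_const h.ell2_diff _).mul (h.γ_diff a b))

theorem lieTen_C (a b : Fin m) : D.lieTen D.C x a b
    = 4 * stens D.ell D.s x a b + D.nDer D.ell2 x / ((m : ℝ) - 1) * D.γ x a b
      + 2 * (D.ell2 x / ((m : ℝ) - 1)) * D.U x a b := by
  have h1 := h.ell_diff
  have h2 := h.ell2_diff
  have h3 := h.γ_diff
  have e : D.C = fun y a b => D.ell y a * D.ell y b
      + ((m : ℝ) - 1)⁻¹ * (D.ell2 y * D.γ y a b) := by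
    ext y a b
    simp only [C]
    ring
  rw [e, lieTen_add, lieTen_tens h1 h1, lieTen_const_mul, lieTen_mul h2 h3, h.lieCov_ell,
    h.lieCov_ell, lieTen_γ, stens_apply]
  · ring
  · exact fun a b => h2.mul (h3 a b)
  · exact fun a b => (h1 a).mul (h1 b)
  · exact fun a b => (h2.mul (h3 a b)).const_mul _

section

variable {V : Tensor m} (hV : ∀ a b, DifferentiableAt ℝ (fun y => V y a b) x)
include hV

theorem Q_diff : DifferentiableAt ℝ (fun y => D.Q V y) x := by
  have := h.nv_diff
  simp only [Q]
  fun_prop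

theorem trP_diff : DifferentiableAt ℝ (fun y => D.trP V y) x := by
  have := h.P_diff
  simp only [trP]
  fun_prop

theorem iota_diff (b : Fin m) : DifferentiableAt ℝ (fun y => D.iota V y b) x := by
  have := h.nv_diff
  simp only [iota]
  fun_prop

theorem hat_bar_diff (a : Fin m) : DifferentiableAt ℝ (fun y => D.hat (D.bar V) y a) x := by
  have hn := h.nv_diff
  have hP := h.P_diff
  have hg := h.γ_diff
  have hi := h.iota_diff hV
  exact DifferentiableAt.fun_sum fun b _ =>
    ((DifferentiableAt.fun_sum fun c _ => (hP b c).fun_mul (hi c)).sub (((h.trP_diff hV).const_mul _).mul (hn b))).mul (hg b a)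

theorem stens_ell_hat_bar_diff (a b : Fin m) :
    DifferentiableAt ℝ (fun y => stens D.ell (D.hat (D.bar V)) y a b) x := by
  have h1 := h.ell_diff
  have h6 := h.hat_bar_diff hV
  exact differentiableAt_div_const (((h1 a).mul (h6 b)).add ((h1 b).mul (h6 a))) 2

theorem hor_diff (a b : Fin m) : DifferentiableAt ℝ (fun y => D.hor V y a b) x :=
  (hV a b).sub ((((h.stens_ell_hat_bar_diff hV a b).const_mul 2).add
    ((h.Q_diff hV).mul (h.C_diff a b))).add ((differentiableAt_div_const (h.trP_diff hV) _).mul (h.γ_diff a b)))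

/-- Leibniz rule on the four pieces of `V`: each `£_n ℓ` contributes `2s`, each `£_n γ` contributes
`2U`, and the bracket after `Q_V` is `£_n 𝒞`. -/
theorem lieTen_decomp (a b : Fin m) : D.lieTen V x a b = D.lieTen (D.hor V) x a b
    + 4 * stens D.s (D.hat (D.bar V)) x a b + 2 * stens D.ell (D.lieCov (D.hat (D.bar V))) x a b
    + D.nDer (D.Q V) x * D.C x a b + D.Q V x * (4 * stens D.ell D.s x a b
      + D.nDer D.ell2 x / ((m : ℝ) - 1) * D.γ x a b
      + 2 * (D.ell2 x / ((m : ℝ) - 1)) * D.U x a b)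
    + D.nDer (D.trP V) x / ((m : ℝ) - 1) * D.γ x a b
    + 2 * (D.trP V x / ((m : ℝ) - 1)) * D.U x a b := by
  have h1 := h.ell_diff
  have h2 := h.γ_diff
  have h3 := h.C_diff
  have h4 := h.trP_diff hV
  have h5 := h.Q_diff hV
  have h6 := h.hat_bar_diff hV
  have h7 := h.hor_diff hV
  have e : V = fun y a b => D.hor V y a b + (2 * stens D.ell (D.hat (D.bar V)) y a b
      + (D.Q V y * D.C y a b + ((m : ℝ) - 1)⁻¹ * (D.trP V y * D.γ y a b))) := by
    ext y a b
    simp only [hor, proj]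
    ring
  have h8 := h.stens_ell_hat_bar_diff hV
  have h9 := fun a b => (h5.mul (h3 a b)).add ((h4.mul (h2 a b)).const_mul ((m : ℝ) - 1)⁻¹)
  have e' := congrArg (fun W => D.lieTen W x a b) e
  refine e'.trans ?_
  rw [lieTen_add, lieTen_add, lieTen_add, lieTen_const_mul, lieTen_const_mul, lieTen_mul h4 h2,
    lieTen_mul h5 h3, lieTen_stens h1 h6, h.lieTen_C, lieTen_γ]
  · simp only [stens_apply, h.lieCov_ell]
    ring
  · exact fun a b => h4.mul (h2 a b)
  · exact h8
  · exact fun a b => h5.mul (h3 a b)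
  · exact fun a b => (h4.mul (h2 a b)).const_mul _
  · exact fun a b => (h8 a b).const_mul _
  · exact h9
  · exact h7
  · exact fun a b => ((h8 a b).const_mul _).add (h9 a b)

/-- Differentiating `ι_n V = V̂ + Q_V ℓ` leaves `∇ℓ` only in symmetrized form, where the defining
property of the connection replaces it by `U`. This is the source of the `2ℓ⁽²⁾p` multiplying `U^H`.
-/
theorem nabla_iota (a b : Fin m) : D.nabla (D.iota V) x a b + D.nabla (D.iota V) x b a
    = D.nabla (D.hat (D.bar V)) x a b + D.nabla (D.hat (D.bar V)) x b a
      + 2 * stens D.ell (fun y c => pd c (D.Q V) y) x a b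
      - 2 * D.Q V x * D.ell2 x * D.U x a b := by
  have h1 := h.ell_diff
  have h5 := h.Q_diff hV
  have h6 := h.hat_bar_diff hV
  have e : ∀ a b, D.nabla (D.iota V) x a b = D.nabla (D.hat (D.bar V)) x a b
      + (pd a (D.Q V) x * D.ell x b + D.Q V x * D.nabla D.ell x a b) := by
    intro a b
    rw [← nabla_mul h5 h1, ← nabla_add (η := fun y a => D.Q V y * D.ell y a) h6 fun a => h5.mul (h1 a)]
    refine nabla_congr (h.null.mono fun y hy a => ?_) a b
    rw [hy.hat_bar]
    ring
  rw [e, e, stens_apply]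
  linear_combination D.Q V x * h.nabla_ell a b

end

/-- The last coefficient of `U` matches the `U` terms of `lieTen_decomp`; in `ε[ℛ]` the factors `4`
here and `-2 · 2` there make them cancel. -/
theorem PTS_decomp (V : Tensor m) (a b : Fin m) : D.PTS V D.U x a b = D.PTS (D.hor V) D.U x a b
    + D.ell x a * (∑ d, ∑ c, D.U x b d * D.P x d c * D.hat (D.bar V) x c)
    + (D.Q V x * (D.ell2 x / ((m : ℝ) - 1)) + D.trP V x / ((m : ℝ) - 1)) * D.U x a b := by
  have hU := h.U_nv
  have k1 := h.nullAt.PTS_γ hU a b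
  have k2 := h.nullAt.PTS_stens_ell hU (D.hat (D.bar V)) a b
  have k3 := h.nullAt.PTS_stens_ell hU D.ell a b
  -- `Pℓ` is proportional to `n`, and `U` kills `n`: the `ℓ ⊗ ℓ` part of `𝒞` contributes nothing.
  have k4 : ∑ d, ∑ c, D.U x b d * D.P x d c * D.ell x c = 0 := by
    have : ∀ d, ∑ c, D.U x b d * D.P x d c * D.ell x c
        = -D.ell2 x * (D.U x b d * D.nv x d) := by
      intro d
      simp only [mul_assoc, ← Finset.mul_sum, h.nullAt.P_ell]
      ring
    simp only [this, ← Finset.mul_sum, hU, mul_zero]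
  rw [k4] at k3
  have e : D.PTS V D.U x a b = D.PTS (D.hor V) D.U x a b
      + 2 * D.PTS (stens D.ell (D.hat (D.bar V))) D.U x a b
      + D.Q V x * D.PTS (stens D.ell D.ell) D.U x a b
      + (D.Q V x * (D.ell2 x / ((m : ℝ) - 1)) + D.trP V x / ((m : ℝ) - 1))
        * D.PTS D.γ D.U x a b := by
    simp only [PTS, Finset.mul_sum, ← Finset.sum_add_distrib]
    refine Finset.sum_congr rfl fun c _ => Finset.sum_congr rfl fun d _ => ?_
    simp only [hor, proj, C, stens_apply]
    ring
  rw [e, k1, k2, k3, h.U_symm b a]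
  ring

end RegularAt

/-! ### The constraint tensor, sorted by degree in `Y` -/

theorem constraintTensor_eq (h : D.RegularAt x) {Y : Tensor m}
    (hY : ∀ a b, DifferentiableAt ℝ (fun y => Y y a b) x) (hs : ∀ a b, Y x a b = Y x b a)
    (a b : Fin m) : D.constraintTensor Y x a b =
      sym D.ric x a b - 2 * D.lieTen Y x a b + (2 * D.Q Y x - D.trP D.U x) * Y x a b
      + sym (D.nabla D.s) x a b + (D.nabla (D.iota Y) x a b + D.nabla (D.iota Y) x b a)
      - 2 * D.iota Y x a * D.iota Y x b + 4 * stens (D.iota Y) D.s x a b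
      - D.s x a * D.s x b - D.trP Y x * D.U x a b + 4 * sym (D.PTS Y D.U) x a b
      + 2 * sym (fun y a b => ∑ c, ∑ d, D.P y c d * D.U y d a * D.F y b c) x a b := by
  have hi := h.iota_diff hY
  have e1 : ∀ a b, D.nabla (fun y c => D.s y c + 2 * D.iota Y y c) x a b
      = D.nabla D.s x a b + 2 * D.nabla (D.iota Y) x a b := by
    intro a b
    have := nabla_mul (D := D) (f := fun _ => (2 : ℝ)) (differentiableAt_const 2) hi a b
    rw [pd_const, zero_mul, zero_add] at this
    rw [← this]
    exact nabla_add h.s_diff (fun a => (hi a).const_mul 2) a b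
  -- This isolates the `F` part, which is independent of `Y` and drops out of the jump; the symmetry
  -- of `Y` and `U` identifies the remainder with a transposed `PTS`.
  have e2 : ∀ a b, ∑ c, ∑ d, D.P x c d * D.U x d a * (2 * Y x b c + D.F x b c)
      = 2 * D.PTS Y D.U x b a + ∑ c, ∑ d, D.P x c d * D.U x d a * D.F x b c := by
    intro a b
    simp only [PTS, Finset.mul_sum, ← Finset.sum_add_distrib]
    refine Finset.sum_congr rfl fun c _ => Finset.sum_congr rfl fun d _ => ?_
    rw [h.U_symm d a, hs b c]
    ring
  simp only [constraintTensor, sym, e1, e2, r, kappa, stens_apply]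
  ring

end LocalData

/-! ### Jumps and averages across the shell -/

namespace LocalShell

open LocalData

variable (Z : LocalShell m)

/-- The tensor `ε [Y]`. -/
noncomputable abbrev jumpY : Tensor m := Z.ε • Z.Yp + (-Z.ε) • Z.Ym

/-- The average `⟨Y⟩`. -/
noncomputable abbrev averageY : Tensor m := (1 / 2 : ℝ) • Z.Yp + (1 / 2 : ℝ) • Z.Ym

theorem μ_eq (y : E m) : Z.μ y = -Z.trP Z.jumpY y := by
  rw [trP_comb, μ]
  ring

theorem p_eq (y : E m) : Z.p y = -Z.Q Z.jumpY y := by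
  rw [Q_comb, p, kappa, kappa]
  ring

theorem Υ_eq : Z.Υ = Z.hor Z.jumpY := by
  ext y a b
  rw [hor_comb, Υ]
  ring

theorem avY_eq : Z.avY = Z.hat (Z.bar Z.averageY) := by
  ext y a
  rw [hat_bar_comb, avY]
  ring

theorem avKappa_eq (y : E m) : Z.avKappa y = -Z.Q Z.averageY y := by
  rw [Q_comb, avKappa, kappa, kappa]
  ring

theorem avTr_eq (y : E m) : Z.avTr y = Z.trP Z.averageY y := by
  rw [trP_comb, avTr]
  ring

theorem avHor_eq : Z.avHor = Z.hor Z.averageY := by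
  ext y a b
  rw [hor_comb, avHor]
  ring

/-- Removing `ℓ(X) n` from a vector does not change `γ(X,·)`. The identity needs the null relations
at the point, so derivatives of `hatJ` are later handled through equality near `x`. -/
theorem hatJ_eq {y : E m} (h : Z.toLocalData.NullAt y) (a : Fin m) :
    Z.hatJ y a = Z.hat (Z.bar Z.jumpY) y a := by
  have e : Z.J = Z.ε • Z.under (Z.bar Z.Yp) + (-Z.ε) • Z.under (Z.bar Z.Ym) := by
    ext y a
    simp only [J, Pi.add_apply, Pi.smul_apply, smul_eq_mul]
    ring
  rw [hatJ, e, hat_comb, hat_bar_comb, h.hat_under, h.hat_under]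

variable {Z} {x : E m}

/-- Polarization of the quadratic terms: `2 Q_Y Y` and `-2 r ⊗ r` become products of an average and
a jump. All other surviving terms are linear in `Y`. -/
theorem jumpR_eq (h : Z.toLocalData.RegularAt x)
    (hp : ∀ a b, DifferentiableAt ℝ (fun y => Z.Yp y a b) x)
    (hm : ∀ a b, DifferentiableAt ℝ (fun y => Z.Ym y a b) x)
    (hps : ∀ a b, Z.Yp x a b = Z.Yp x b a) (hms : ∀ a b, Z.Ym x a b = Z.Ym x b a)
    (a b : Fin m) : Z.ε * Z.jumpR x a b =
      -2 * Z.lieTen Z.jumpY x a b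
      + 2 * (Z.Q Z.averageY x * Z.jumpY x a b + Z.Q Z.jumpY x * Z.averageY x a b)
      - Z.trP Z.U x * Z.jumpY x a b
      + (Z.nabla (Z.iota Z.jumpY) x a b + Z.nabla (Z.iota Z.jumpY) x b a)
      - 4 * stens (Z.iota Z.averageY) (Z.iota Z.jumpY) x a b
      + 4 * stens (Z.iota Z.jumpY) Z.s x a b
      - Z.trP Z.jumpY x * Z.U x a b + 4 * sym (Z.PTS Z.jumpY Z.U) x a b := by
  have hip := h.iota_diff hp
  have him := h.iota_diff hm
  have e : ∀ a b, Z.nabla (Z.iota Z.jumpY) x a b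
      = Z.ε * Z.nabla (Z.iota Z.Yp) x a b + -Z.ε * Z.nabla (Z.iota Z.Ym) x a b := by
    intro a b
    have k1 := nabla_mul (D := Z.toLocalData) (differentiableAt_const Z.ε) hip a b
    have k2 := nabla_mul (D := Z.toLocalData) (differentiableAt_const (-Z.ε)) him a b
    rw [pd_const, zero_mul, zero_add] at k1 k2
    rw [← k1, ← k2, ← nabla_add (fun a => (hip a).const_mul _) fun a => (him a).const_mul _]
    exact nabla_congr (Filter.Eventually.of_forall fun y a => iota_comb _ _ _ _ a) a b
  rw [jumpR, constraintTensor_eq h hp hps, constraintTensor_eq h hm hms, e, e,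
    lieTen_comb _ _ hp hm]
  simp only [stens_apply, sym, trP_comb, Q_comb, iota_comb, PTS_comb, Pi.add_apply,
    Pi.smul_apply, smul_eq_mul]
  ring

theorem mul_jumpR (h : Z.toLocalData.RegularAt x)
    (hp : ∀ a b, DifferentiableAt ℝ (fun y => Z.Yp y a b) x)
    (hm : ∀ a b, DifferentiableAt ℝ (fun y => Z.Ym y a b) x)
    (hps : ∀ a b, Z.Yp x a b = Z.Yp x b a) (hms : ∀ a b, Z.Ym x a b = Z.Ym x b a)
    (a b : Fin m) : Z.ε * Z.jumpR x a b =
      stens Z.ell (fun y c => -2 * Z.lieCov Z.hatJ y c - 2 * Z.trP Z.U y * Z.hatJ y c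
          - 2 * Z.Dd Z.p y c + 4 * Z.s y c * Z.p y) x a b
      + Z.p x * Z.trP Z.U x * Z.C x a b
      + 2 / ((m : ℝ) - 1) *
          (Z.nDer (fun y => Z.ell2 y * Z.p y + Z.μ y) x
            + Z.trP (fun y c d => Z.nabla Z.hatJ y c d - 2 * stens Z.avY Z.hatJ y c d
                - 2 * stens Z.hatJ Z.s y c d) x
            + 2 * Z.ell2 x * Z.avKappa x * Z.p x
            + Z.avKappa x * Z.μ x - Z.avTr x * Z.p x
            + Z.trP Z.U x * (Z.ell2 x * Z.p x + Z.μ x)) * Z.γ x a b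
      - 2 * Z.lieBar Z.Υ x a b + Z.O Z.hatJ x a b
      - 4 * Z.hor (stens Z.avY Z.hatJ) x a b
      - 4 * Z.hor (stens Z.s Z.hatJ) x a b
      - 2 * Z.avKappa x * Z.Υ x a b - 2 * Z.p x * Z.avHor x a b
      - Z.trP Z.U x * Z.Υ x a b
      + (Z.μ x + 2 * Z.ell2 x * Z.p x) * Z.hor Z.U x a b := by
  have hV : ∀ a b, DifferentiableAt ℝ (fun y => Z.jumpY y a b) x := fun a b =>
    ((hp a b).const_mul _).add ((hm a b).const_mul _)
  have hJ : ∀ᶠ y in nhds x, ∀ a, Z.hatJ y a = Z.hat (Z.bar Z.jumpY) y a :=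
    h.null.mono fun y hy a => Z.hatJ_eq hy a
  have h0 := h.nullAt
  have hQ := h.Q_diff hV
  have ht := h.trP_diff hV
  have hJn : ∑ c, Z.hatJ x c * Z.nv x c = 0 := by
    simp only [hJ.self_of_nhds, h0.hat_bar_nv]
  -- All the covectors involved vanish on `n`, so here and in `k2` the operation `(·)^H` reduces to
  -- removing a trace; `k3` does the same for `U`.
  have k1 := h0.hor_of_iota (V := stens Z.avY Z.hatJ)
    (fun b => by rw [iota_stens, hJn, avY_eq, h0.hat_bar_nv]; simp) a b
  have k2 := h0.hor_of_iota (V := stens Z.s Z.hatJ)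
    (fun b => by rw [iota_stens, hJn, NullAt.s_nv]; simp) a b
  have k3 := h0.hor_of_iota h.iota_U a b
  have k4 := h0.lieBar_of_iota (h0.iota_hor Z.jumpY) a b
  have k5 : Z.nDer (fun y => Z.ell2 y * Z.p y + Z.μ y) x
      = -(Z.nDer Z.ell2 x * Z.Q Z.jumpY x + Z.ell2 x * Z.nDer (Z.Q Z.jumpY) x)
        - Z.nDer (Z.trP Z.jumpY) x := by
    have : (fun y => Z.ell2 y * Z.p y + Z.μ y)
        = fun y => (-1) * (Z.ell2 y * Z.Q Z.jumpY y + Z.trP Z.jumpY y) := by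
      ext y
      rw [p_eq, μ_eq]
      ring
    rw [this, nDer_mul (differentiableAt_const _) ((h.ell2_diff.fun_mul hQ).fun_add ht),
      nDer_add (h.ell2_diff.fun_mul hQ) ht, nDer_mul h.ell2_diff hQ, nDer_const]
    ring
  have k6 : ∀ c, pd c Z.p x = -pd c (Z.Q Z.jumpY) x := by
    intro c
    rw [show Z.p = fun y => (-1) * Z.Q Z.jumpY y by ext y; rw [p_eq]; ring, pd_const_mul hQ]
    ring
  have k7 : Z.nDer Z.p x = -Z.nDer (Z.Q Z.jumpY) x := by
    simp only [nDer, k6, mul_neg, Finset.sum_neg_distrib]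
  have k8 : Z.trP (fun y c d => Z.nabla Z.hatJ y c d - 2 * stens Z.avY Z.hatJ y c d
      - 2 * stens Z.hatJ Z.s y c d) x = Z.trP (Z.nabla Z.hatJ) x
      - 2 * Z.trP (stens Z.avY Z.hatJ) x - 2 * Z.trP (stens Z.s Z.hatJ) x := by
    rw [trP_sub, trP_sub, trP_const_mul, trP_const_mul, stens_comm Z.hatJ Z.s]
  have k9 : ∀ c, Z.iota Z.jumpY x c = Z.hatJ x c - Z.p x * Z.ell x c := by
    intro c
    rw [hJ.self_of_nhds, h0.hat_bar, p_eq]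
    ring
  have k10 : ∀ c, Z.iota Z.averageY x c = Z.avY x c - Z.avKappa x * Z.ell x c := by
    intro c
    rw [avY_eq, h0.hat_bar, avKappa_eq]
    ring
  -- The decompositions of `ε[Y]` and, next, of `⟨Y⟩`, in the physical variables; the minus signs
  -- come from those in the definitions of `p`, `μ` and `κ_n`.
  have eV : Z.jumpY x a b = Z.Υ x a b + 2 * stens Z.ell Z.hatJ x a b - Z.p x * Z.C x a b
      - Z.μ x / ((m : ℝ) - 1) * Z.γ x a b := by
    rw [Υ_eq, p_eq, μ_eq]
    simp only [hor, proj, stens_apply, hJ.self_of_nhds]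
    ring
  have eA : Z.averageY x a b = Z.avHor x a b + 2 * stens Z.ell Z.avY x a b
      - Z.avKappa x * Z.C x a b + Z.avTr x / ((m : ℝ) - 1) * Z.γ x a b := by
    rw [avHor_eq, avY_eq, avKappa_eq, avTr_eq]
    simp only [hor, proj, stens_apply]
    ring
  rw [jumpR_eq h hp hm hps hms, h.nabla_iota hV, h.lieTen_decomp hV, eV, eA, k1, k2, k3, k5, k8,
    Υ_eq, k4]
  simp only [O, Dd, stens_apply, sym, k6, k7, k9, k10, h.PTS_decomp Z.jumpY,
    ← lieCov_congr hJ, ← nabla_congr hJ, ← hJ.self_of_nhds]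
  -- The double negations expose `-Q` and `-tr_P`, so that both sides are written in the same atoms
  -- `p`, `μ` and `⟨κ_n⟩`.
  rw [← neg_neg (Z.Q Z.jumpY x), ← p_eq, ← neg_neg (Z.trP Z.jumpY x), ← μ_eq,
    ← neg_neg (Z.Q Z.averageY x), ← avKappa_eq, h.U_symm b a]
  -- The products of `ι_n` terms yield bare `ℓ ⊗ ℓ`, which can only combine with the `𝒞` terms once
  -- `𝒞` is expanded.
  simp only [C]
  ring

end LocalShell

/-! ### From the manifold to charts -/

theorem NullMetricHypersurfaceData.regularAt_inChart {N : Type*} [TopologicalSpace N]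
    [ChartedSpace (E m) N] [IsManifold (𝓡 m) ∞ N] (D : NullMetricHypersurfaceData m N)
    {φ : OpenPartialHomeomorph N (E m)} (hφ : φ ∈ IsManifold.maximalAtlas (𝓡 m) ∞ N)
    {x : E m} (hx : x ∈ φ.target) : (D.inChart φ).RegularAt x := by
  have hn := φ.open_target.mem_nhds hx
  have dif : ∀ {f : E m → ℝ}, ContDiffOn ℝ ∞ f φ.target → DifferentiableAt ℝ f x := fun hf =>
    (hf.contDiffAt hn).differentiableAt (by simp)
  -- `s` already contains `dℓ`, so its differentiability requires a second derivative of `ℓ`.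
  have hell : ∀ a b, DifferentiableAt ℝ (fun y => pd a (fun z => (D.inChart φ).ell z b) y) x := by
    intro a b
    have h1 : ContDiffAt ℝ ∞ (fun z => (D.inChart φ).ell z b) x :=
      (D.ell.comp_smooth hφ b).contDiffAt hn
    have h2 : ContDiffAt ℝ 1 (fderiv ℝ fun z => (D.inChart φ).ell z b) x :=
      h1.fderiv_right (by norm_cast)
    exact (h2.differentiableAt (by simp)).clm_apply (differentiableAt_const _)
  have hnv : ∀ a, DifferentiableAt ℝ (fun y => (D.inChart φ).nv y a) x := fun a =>
    dif (D.nv_smooth hφ a)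
  refine ⟨Filter.eventually_of_mem hn fun y hy => ?_, fun a b => dif (D.γ.comp_smooth hφ a b),
    fun a => dif (D.ell.comp_smooth hφ a), dif (D.ell2_comp_smooth hφ),
    fun a b => dif (D.inv_smooth hφ _ _), hnv, fun a => ?_,
    ((D.eq_christoffel_iff hφ hx _).1 rfl).2.2⟩
  · obtain ⟨r1, r2, r3, r4⟩ := D.relations hφ hy
    have hs : ∀ a b, (D.inChart φ).γ y a b = (D.inChart φ).γ y b a :=
      fun a b => D.γ.symm _ _ _
    refine ⟨hs, fun a b => ?_, r1, r2, fun a => ?_, fun a c => ?_⟩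
    · have ht : ((D.inChart φ).ambient y).transpose = (D.inChart φ).ambient y := by
        ext i j
        rcases i with i | i <;> rcases j with j | j <;>
          simp [LocalData.ambient, Matrix.transpose_apply]
        exact hs j i
      have := Matrix.transpose_nonsing_inv ((D.inChart φ).ambient y)
      rw [ht] at this
      exact congrFun (congrFun this (Sum.inl b)) (Sum.inl a)
    · linear_combination r3 a
    · linear_combination r4 a c
  · simp only [LocalData.s, LocalData.iota, LocalData.F]
    exact DifferentiableAt.fun_sum fun b _ =>
      (hnv b).fun_mul (((hell b a).fun_sub (hell a b)).const_mul (1 / 2))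

end NullShells

open NullShells in
theorem proposition7p1 {m : ℕ} (hm : 2 ≤ m) {N : Type*} [TopologicalSpace N]
    [T2Space N] [SecondCountableTopology N] [ChartedSpace (E m) N] [IsManifold (𝓡 m) ∞ N]
    (S : NullShell m N) (φ : OpenPartialHomeomorph N (E m))
    (hφ : φ ∈ IsManifold.maximalAtlas (𝓡 m) ∞ N) (x : E m) (hx : x ∈ φ.target) (a b : Fin m)
    (Z : LocalShell m) (hZ : Z = S.inChart φ) :
    Z.ε * Z.jumpR x a b =
      stens Z.ell (fun y c => -2 * Z.lieCov Z.hatJ y c - 2 * Z.trP Z.U y * Z.hatJ y c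
          - 2 * Z.Dd Z.p y c + 4 * Z.s y c * Z.p y) x a b
      + Z.p x * Z.trP Z.U x * Z.C x a b
      + 2 / ((m : ℝ) - 1) *
          (Z.nDer (fun y => Z.ell2 y * Z.p y + Z.μ y) x
            + Z.trP (fun y c d => Z.nabla Z.hatJ y c d - 2 * stens Z.avY Z.hatJ y c d
                - 2 * stens Z.hatJ Z.s y c d) x
            + 2 * Z.ell2 x * Z.avKappa x * Z.p x
            + Z.avKappa x * Z.μ x - Z.avTr x * Z.p x
            + Z.trP Z.U x * (Z.ell2 x * Z.p x + Z.μ x)) * Z.γ x a b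
      - 2 * Z.lieBar Z.Υ x a b + Z.O Z.hatJ x a b
      - 4 * Z.hor (stens Z.avY Z.hatJ) x a b
      - 4 * Z.hor (stens Z.s Z.hatJ) x a b
      - 2 * Z.avKappa x * Z.Υ x a b - 2 * Z.p x * Z.avHor x a b
      - Z.trP Z.U x * Z.Υ x a b
      + (Z.μ x + 2 * Z.ell2 x * Z.p x) * Z.hor Z.U x a b := by
  subst hZ
  have hn := φ.open_target.mem_nhds hx
  exact LocalShell.mul_jumpR (S.regularAt_inChart hφ hx)
    (fun a b => ((S.Yp.comp_smooth hφ a b).contDiffAt hn).differentiableAt (by simp))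
    (fun a b => ((S.Ym.comp_smooth hφ a b).contDiffAt hn).differentiableAt (by simp))
    (fun a b => S.Yp.symm _ _ _) (fun a b => S.Ym.symm _ _ _) a b
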